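/- Let $d,M,K\ge 1$ be integers and let $\{|\omega\rangle\}_{\omega=1}^d$ be the standard orthonormal basis of $\mathbb C^d$. Let $e^{i\theta_{mk}(\omega)}$ ($1\le m\le M$, $1\le k\le K$, $1\le\omega\le d$) be independent identically distributed random phases with $\mathbb E\big[e^{i\theta_{mk}(\omega)}\big]=0$ (for example uniformly random signs $\pm1$), and consider the $MK$ i.i.d. random codewords $$|\psi_{mk}\rangle=\frac1{\sqrt d}\sum_{\omega=1}^d e^{i\theta_{mk}(\omega)}|\omega\rangle .$$ When the message $m$ is uniform and the key $k$ is uniform and unknown to the eavesdropper Eve, the joint state of the message register $A$ and of the system $E$ that Eve intercepts is $$\rho_{AE}=\frac1M\sum_{m=1}^M|m\rangle\langle m|_A\otimes\frac1K\sum_{k=1}^K|\psi_{mk}\rangle\langle\psi_{mk}|_E .$$ Eve's accessible information $I_{\rm acc}$ is the supremum, over all local measurements (POVMs with finitely many outcomes) on $A$ and on $E$, with outcomes $X$ and $Y$ respectively, of the mutual information $H(X)+H(Y)-H(X,Y)$, where $H$ is the Shannon entropy and $\log$ is the logarithm to base $2$. There is an absolute constant $C>0$ (independent of $d,M,K,\delta$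 and of the distribution of the phases) such that for every $\delta>0$ with $$K>\frac4{\delta^2}\left(\ln M+\frac{2d}{\delta M}\ln\frac5\delta\right),$$ the probability $p_{\rm fail}$ that $I_{\rm acc}\le C\,\delta\log d$ does not hold satisfies $$p_{\rm fail}\le\exp\left[-M\left(\frac{\delta^3K}4-\delta\ln M-\frac{2d}M\ln\frac5\delta\right)\right],$$ where the factor in parentheses multiplying $-M$ in the exponent is strictly positive. In particular this holds in the regime $MK\gg d$, $M\ll d$. -/

import Mathlib

open MeasureTheory ProbabilityTheory
open scoped Kronecker ComplexOrder

namespace DataLocking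

noncomputable section

/-- A positive operator-valued measurement with finitely many outcomes `ι` on the
finite-dimensional system `ℂ^n`. -/
structure POVM (ι n : Type*) [Fintype ι] [Fintype n] [DecidableEq n] where
  /-- the measurement operators -/
  effect : ι → Matrix n n ℂ
  posSemidef : ∀ i, (effect i).PosSemidef
  sum_effect : ∑ i, effect i = 1

/-- Shannon entropy, in bits, of a finite family of probabilities (with `0 log 0 = 0`). -/
def shannonEntropy {ι : Type*} [Fintype ι] (p : ι → ℝ) : ℝ :=
  ∑ i, -(p i * Real.logb 2 (p i))

/-- Mutual information `H(X) + H(Y) - H(X,Y)`, in bits, of a joint distribution `p` of `(X, Y)`. -/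
def mutualInfo {ι κ : Type*} [Fintype ι] [Fintype κ] (p : ι × κ → ℝ) : ℝ :=
  shannonEntropy (fun x => ∑ y, p (x, y)) + shannonEntropy (fun y => ∑ x, p (x, y))
    - shannonEntropy p

/-- Born rule: joint distribution of the outcomes when the local measurements `A` and `E` are
applied to the two subsystems of a bipartite state `ρ`. -/
def outcomeProb {ι κ a e : Type*} [Fintype ι] [Fintype κ] [Fintype a] [DecidableEq a]
    [Fintype e] [DecidableEq e] (ρ : Matrix (a × e) (a × e) ℂ) (A : POVM ι a) (E : POVM κ e) :
    ι × κ → ℝ :=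
  fun xy => (((A.effect xy.1 ⊗ₖ E.effect xy.2) * ρ).trace).re

/-- Accessible information of a bipartite state: the supremum, over all pairs of local
measurements with finitely many outcomes, of the mutual information of the outcomes. -/
def accessibleInfo {a e : Type*} [Fintype a] [DecidableEq a] [Fintype e] [DecidableEq e]
    (ρ : Matrix (a × e) (a × e) ℂ) : EReal :=
  ⨆ (I : ℕ) (J : ℕ) (A : POVM (Fin I) a) (E : POVM (Fin J) e),
    ((mutualInfo (outcomeProb ρ A E) : ℝ) : EReal)

/-- The vector `d^{-1/2} ∑_ω e^{i θ(ω)} |ω⟩` of `ℂ^d`. -/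
def phaseVector {d : ℕ} (θ : Fin d → ℝ) : Fin d → ℂ :=
  fun ω => ((1 / Real.sqrt d : ℝ) : ℂ) * Complex.exp (Complex.I * (θ ω : ℂ))

/-- The state of the message register and of the transmitted system when the message `m` is
uniform and the key `k` is uniform and unknown:
`(1/M) ∑_m |m⟩⟨m| ⊗ (1/K) ∑_k |ψ_mk⟩⟨ψ_mk|`. -/
def messageState {d M K : ℕ} (ψ : Fin M → Fin K → Fin d → ℂ) :
    Matrix (Fin M × Fin d) (Fin M × Fin d) ℂ :=
  (1 / (M : ℂ)) • ∑ m : Fin M, Matrix.single m m (1 : ℂ) ⊗ₖ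
    ((1 / (K : ℂ)) • ∑ k : Fin K, Matrix.vecMulVec (ψ m k) (star (ψ m k)))

/-- The numbers `e^{i θ_j}` are independent, identically distributed random phases of
mean zero. -/
structure IsZeroMeanIIDPhases {Ω ι : Type*} [MeasurableSpace Ω] (P : Measure Ω)
    (θ : ι → Ω → ℝ) : Prop where
  measurable : ∀ j, Measurable (fun w => Complex.exp (Complex.I * (θ j w : ℂ)))
  indep : iIndepFun (fun j w => Complex.exp (Complex.I * (θ j w : ℂ))) P
  identDistrib : ∀ j j', IdentDistrib (fun w => Complex.exp (Complex.I * (θ j w : ℂ)))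
    (fun w => Complex.exp (Complex.I * (θ j' w : ℂ))) P P
  mean_zero : ∀ j, ∫ w, Complex.exp (Complex.I * (θ j w : ℂ)) ∂P = 0

end

end DataLocking

/-! Each outcome law on Eve's side is compared with `w y = tr E_y / d`, the law that the maximally
mixed state would give. Every codeword has flat coordinates, so no outcome is more than `d` times
likelier than under `w`. Relative entropy to the product law is then at most `3 log d` times the
total variation distance (`mutualInfo_le_sum_max`). Positive and negative parts of the difference
have equal mass, so only outcomes less likely than under `w` need control. Splitting effects into
rank-one pieces leaves one condition: for every unit vector `c`, the shortfalls of the key-averaged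
overlaps below 1, added over the messages, are at most `30 δ M`.

Lower tails are cheap. The overlap `|∑ c_ω z_ω|²` is nonnegative with mean 1 and fourth moment of
the sum at most 3, so its Laplace transform is controlled although it may be as large as `d`.
Averaging over `K` keys makes the exponential moment of one message's shortfall at most `1 + 1/M`
once `K δ²` dominates `log M`; the `M` messages together cost a factor `e`, and Chernoff gives `exp
(1 - δ² K M)` for a fixed direction.

Passing to all directions requires a net of size `(O(1)/δ)^(2d)`, without a `log d` in the exponent.
Controlling a rounding error `u` by the worst case `d |u|²` would need too fine a mesh. Instead the
lattice point is chosen, depending on the codewords, so that the rounding errors do not add up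
coherently on average over all codewords (`exists_latticePoint_near`); the lattice itself is fixed,
so the union bound still applies. -/

namespace DataLocking

/-! ### Mutual information against total variation. -/

lemma mul_log_sub_log_le {P W D : ℝ} (hP : 0 ≤ P) (hW : 0 ≤ W) (hPW : P ≤ D * W)
    (hD : D = 1 ∨ 2 ≤ D) :
    P * (Real.log P - Real.log W) ≤ 3 * Real.log D * max 0 (P - W) := by
  have hlogD : 0 ≤ Real.log D := by
    rcases hD with h | h
    · simp [h]
    · exact Real.log_nonneg (by linarith)
  rcases hP.eq_or_lt with rfl | hP0
  · rw [zero_mul]; positivity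
  have hW0 : 0 < W := by
    rcases hW.eq_or_lt with rfl | h
    · linarith
    · exact h
  rcases le_or_gt P W with h | h
  · have := Real.log_le_log hP0 h
    have h2 : P * (Real.log P - Real.log W) ≤ 0 :=
      mul_nonpos_of_nonneg_of_nonpos hP (by linarith)
    have : 0 ≤ 3 * Real.log D * max 0 (P - W) := by positivity
    linarith
  · have hD2 : 2 ≤ D := by
      rcases hD with rfl | h'
      · linarith
      · exact h'
    rw [max_eq_right (by linarith)]
    have h1 : Real.log P - Real.log W ≤ Real.log D := by
      have := Real.log_le_log hP0 hPW
      rw [Real.log_mul (by linarith) hW0.ne'] at this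
      linarith
    have h2 : W * (Real.log P - Real.log W) ≤ P - W := by
      rw [← Real.log_div hP0.ne' hW0.ne']
      have := Real.log_le_sub_one_of_pos (div_pos hP0 hW0)
      calc W * Real.log (P / W) ≤ W * (P / W - 1) := by gcongr
        _ = P - W := by field_simp
    -- Write `P = W + (P - W)`: the first part contributes at most `P - W`, the second `(P - W) log
    -- D`. Absorbing the former costs `2 log D`, hence the 3; this needs `D` away from 1. For `D =
    -- 1` one has `P ≤ W`.
    have h3 : 1 ≤ 2 * Real.log D := by
      have := Real.log_le_log (by norm_num) hD2
      have := Real.log_two_gt_d9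
      linarith
    have h4 : (P - W) * (Real.log P - Real.log W) ≤ (P - W) * Real.log D :=
      mul_le_mul_of_nonneg_left h1 (by linarith)
    have h5 : (P - W) * 1 ≤ (P - W) * (2 * Real.log D) :=
      mul_le_mul_of_nonneg_left h3 (by linarith)
    linarith

/-- Gibbs' inequality. -/
lemma sum_mul_log_sub_log_nonpos {κ : Type*} [Fintype κ] {q w : κ → ℝ} (hq : ∀ y, 0 ≤ q y)
    (hw : ∀ y, 0 ≤ w y) (hsum : ∑ y, w y ≤ ∑ y, q y) (hac : ∀ y, w y = 0 → q y = 0) :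
    ∑ y, q y * (Real.log (w y) - Real.log (q y)) ≤ 0 := by
  have key : ∀ y, q y * (Real.log (w y) - Real.log (q y)) ≤ w y - q y := by
    intro y
    rcases (hq y).eq_or_lt with h | h
    · rw [← h]; simpa using hw y
    have hw0 : 0 < w y := lt_of_le_of_ne (hw y) fun h' => h.ne' (hac y h'.symm)
    rw [← Real.log_div hw0.ne' h.ne']
    calc q y * Real.log (w y / q y) ≤ q y * (w y / q y - 1) :=
          mul_le_mul_of_nonneg_left (Real.log_le_sub_one_of_pos (div_pos hw0 h)) h.le
      _ = w y - q y := by field_simp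
  calc _ ≤ ∑ y, (w y - q y) := Finset.sum_le_sum fun y _ => key y
    _ ≤ 0 := by rw [Finset.sum_sub_distrib]; linarith

/-- The mutual information is controlled by the total variation distance to a product
distribution that dominates the joint one up to a factor `D`. -/
lemma mutualInfo_le_sum_max {ι κ : Type*} [Fintype ι] [Fintype κ] {p : ι × κ → ℝ} {w : κ → ℝ}
    {D : ℝ} (hD : D = 1 ∨ 2 ≤ D) (hp : ∀ z, 0 ≤ p z) (hw : ∀ y, 0 ≤ w y)
    (hp1 : ∑ x, ∑ y, p (x, y) = 1) (hw1 : ∑ y, w y = 1)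
    (hle : ∀ x y, p (x, y) ≤ D * ((∑ y', p (x, y')) * w y)) :
    mutualInfo p ≤
      3 * Real.logb 2 D * ∑ x, ∑ y, max 0 ((∑ y', p (x, y')) * w y - p (x, y)) := by
  set a : ι → ℝ := fun x => ∑ y, p (x, y) with ha
  set b : κ → ℝ := fun y => ∑ x, p (x, y) with hb
  have ha0 : ∀ x, 0 ≤ a x := fun x => Finset.sum_nonneg fun _ _ => hp _
  have hb0 : ∀ y, 0 ≤ b y := fun y => Finset.sum_nonneg fun _ _ => hp _
  have hl2 : 0 < Real.log 2 := Real.log_pos (by norm_num)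
  have hbsum : ∑ y, b y = 1 := by rw [hb, Finset.sum_comm]; exact hp1
  have hH : mutualInfo p * Real.log 2 =
      ∑ x, ∑ y, p (x, y) * (Real.log (p (x, y)) - Real.log (a x) - Real.log (b y)) := by
    have e1 : ∑ x, a x * Real.log (a x) = ∑ x, ∑ y, p (x, y) * Real.log (a x) := by
      simp only [ha, Finset.sum_mul]
    have e2 : ∑ y, b y * Real.log (b y) = ∑ x, ∑ y, p (x, y) * Real.log (b y) := by
      rw [Finset.sum_comm]; simp only [hb, Finset.sum_mul]
    have e4 : shannonEntropy p * Real.log 2 = - ∑ x, ∑ y, p (x, y) * Real.log (p (x, y)) := by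
      rw [shannonEntropy, Finset.sum_mul, Fintype.sum_prod_type, ← Finset.sum_neg_distrib]
      refine Finset.sum_congr rfl fun i _ => ?_
      rw [← Finset.sum_neg_distrib]
      refine Finset.sum_congr rfl fun j _ => ?_
      rw [Real.logb]; field_simp
    have e5 : shannonEntropy a * Real.log 2 = - ∑ i, a i * Real.log (a i) := by
      rw [shannonEntropy, Finset.sum_mul, ← Finset.sum_neg_distrib]
      refine Finset.sum_congr rfl fun i _ => ?_
      rw [Real.logb]; field_simp
    have e6 : shannonEntropy b * Real.log 2 = - ∑ i, b i * Real.log (b i) := by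
      rw [shannonEntropy, Finset.sum_mul, ← Finset.sum_neg_distrib]
      refine Finset.sum_congr rfl fun i _ => ?_
      rw [Real.logb]; field_simp
    rw [mutualInfo, sub_mul, add_mul, e4, e5, e6, e1, e2]
    simp only [mul_sub, Finset.sum_sub_distrib]
    ring
  have hac : ∀ y, w y = 0 → b y = 0 := by
    intro y h
    refine Finset.sum_eq_zero fun x _ => le_antisymm ?_ (hp _)
    simpa [h] using hle x y
  have hG := sum_mul_log_sub_log_nonpos hb0 hw (by rw [hw1, hbsum]) hac
  -- `D(p ‖ a ⊗ b) = D(p ‖ a ⊗ w) - D(b ‖ w)`, so replacing the true marginal `b` by `w` only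
  -- increases the bound.
  have hsplit : ∑ x, ∑ y, p (x, y) * (Real.log (p (x, y)) - Real.log (a x) - Real.log (b y)) =
      ∑ x, ∑ y, p (x, y) * (Real.log (p (x, y)) - Real.log (a x * w y)) +
        ∑ y, b y * (Real.log (w y) - Real.log (b y)) := by
    have : ∑ y, b y * (Real.log (w y) - Real.log (b y)) =
        ∑ x, ∑ y, p (x, y) * (Real.log (w y) - Real.log (b y)) := by
      rw [Finset.sum_comm]; simp only [hb, Finset.sum_mul]
    rw [this, ← Finset.sum_add_distrib]
    refine Finset.sum_congr rfl fun x _ => ?_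
    rw [← Finset.sum_add_distrib]
    refine Finset.sum_congr rfl fun y _ => ?_
    rcases (hp (x, y)).eq_or_lt with h | h
    · rw [← h]; simp
    · have hlt := lt_of_lt_of_le h (hle x y)
      have hne : a x * w y ≠ 0 := by
        intro h0
        change 0 < D * (a x * w y) at hlt
        rw [h0] at hlt; simp at hlt
      rw [Real.log_mul (left_ne_zero_of_mul hne) (right_ne_zero_of_mul hne)]
      ring
  have hmain : ∑ x, ∑ y, p (x, y) * (Real.log (p (x, y)) - Real.log (a x * w y)) ≤
      3 * Real.log D * ∑ x, ∑ y, max 0 (p (x, y) - a x * w y) := by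
    rw [Finset.mul_sum]
    refine Finset.sum_le_sum fun x _ => ?_
    rw [Finset.mul_sum]
    exact Finset.sum_le_sum fun y _ =>
      mul_log_sub_log_le (hp _) (mul_nonneg (ha0 x) (hw y)) (hle x y) hD
  -- Both laws have the same mass, so excess and deficit agree. Passing to the deficit is what makes
  -- lower-tail estimates sufficient.
  have hswap : ∑ x, ∑ y, max 0 (p (x, y) - a x * w y) =
      ∑ x, ∑ y, max 0 (a x * w y - p (x, y)) := by
    have : ∀ s : ℝ, max 0 s = max 0 (-s) + s := by
      intro s
      rcases le_total 0 s with h | h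
      · rw [max_eq_right h, max_eq_left (by linarith)]; ring
      · rw [max_eq_left h, max_eq_right (by linarith)]; ring
    have h0 : ∑ x, ∑ y, (p (x, y) - a x * w y) = 0 := by
      simp only [Finset.sum_sub_distrib, ← Finset.mul_sum, hw1, mul_one]
      exact sub_self _
    calc ∑ x, ∑ y, max 0 (p (x, y) - a x * w y)
        = ∑ x, ∑ y, (max 0 (a x * w y - p (x, y)) + (p (x, y) - a x * w y)) := by
          refine Finset.sum_congr rfl fun x _ => Finset.sum_congr rfl fun y _ => ?_
          rw [this, neg_sub]
      _ = _ := by simp only [Finset.sum_add_distrib, h0, add_zero]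
  rw [Real.logb, ← hswap]
  have : mutualInfo p * Real.log 2 ≤ 3 * Real.log D * ∑ x, ∑ y, max 0 (p (x, y) - a x * w y) := by
    rw [hH, hsplit]; linarith
  calc mutualInfo p = mutualInfo p * Real.log 2 / Real.log 2 := by field_simp
    _ ≤ (3 * Real.log D * ∑ x, ∑ y, max 0 (p (x, y) - a x * w y)) / Real.log 2 := by gcongr
    _ = _ := by ring

/-! ### Overlaps and measurement statistics. -/

/-- Average over the key of `|∑_ω c_ω z_k(ω)|²`. For `z_k = √d ψ_k` this is `d ⟨c̄|ρ|c̄⟩`, where `ρ`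
is the average of the projectors `|ψ_k⟩⟨ψ_k|`. -/
noncomputable def meanOverlap {d K : ℕ} (z : Fin K → Fin d → ℂ) (c : Fin d → ℂ) : ℝ :=
  (1 / (K : ℝ)) * ∑ k, ‖∑ ω, c ω * z k ω‖ ^ 2

/-- The phases `e^{i θ}`. -/
noncomputable def phases {d K : ℕ} (θ : Fin K → Fin d → ℝ) : Fin K → Fin d → ℂ :=
  fun k ω => Complex.exp (Complex.I * (θ k ω : ℂ))

lemma norm_phases {d K : ℕ} (θ : Fin K → Fin d → ℝ) (k : Fin K) (ω : Fin d) :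
    ‖phases θ k ω‖ = 1 := by
  rw [phases, mul_comm, Complex.norm_exp_ofReal_mul_I]

lemma meanOverlap_nonneg {d K : ℕ} (z : Fin K → Fin d → ℂ) (c : Fin d → ℂ) :
    0 ≤ meanOverlap z c := by
  unfold meanOverlap; positivity

lemma norm_sum_mul_sq_le {d : ℕ} {z : Fin d → ℂ} (hz : ∀ ω, ‖z ω‖ = 1) (c : Fin d → ℂ) :
    ‖∑ ω, c ω * z ω‖ ^ 2 ≤ d * ∑ ω, ‖c ω‖ ^ 2 := by
  have h1 : ‖∑ ω, c ω * z ω‖ ≤ ∑ ω, ‖c ω‖ := by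
    refine (norm_sum_le _ _).trans (Finset.sum_le_sum fun ω _ => ?_)
    rw [norm_mul, hz, mul_one]
  have h2 := sq_sum_le_card_mul_sum_sq (s := (Finset.univ : Finset (Fin d))) (f := fun ω => ‖c ω‖)
  rw [Finset.card_univ, Fintype.card_fin] at h2
  exact (pow_le_pow_left₀ (norm_nonneg _) h1 2).trans h2

lemma meanOverlap_le {d K : ℕ} (hK : 0 < K) {z : Fin K → Fin d → ℂ}
    (hz : ∀ k ω, ‖z k ω‖ = 1) (c : Fin d → ℂ) :
    meanOverlap z c ≤ d * ∑ ω, ‖c ω‖ ^ 2 := by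
  have hK' : (0 : ℝ) < K := by exact_mod_cast hK
  unfold meanOverlap
  calc (1 / (K : ℝ)) * ∑ k, ‖∑ ω, c ω * z k ω‖ ^ 2
      ≤ (1 / (K : ℝ)) * ∑ _k : Fin K, (d * ∑ ω, ‖c ω‖ ^ 2) := by
        gcongr with k; exact norm_sum_mul_sq_le (hz k) c
    _ = _ := by
        rw [Finset.sum_const, Finset.card_univ, Fintype.card_fin, nsmul_eq_mul]; field_simp

lemma trace_vecMulVec_mul_phaseVector {d : ℕ} (v : Fin d → ℂ) (θ : Fin d → ℝ) :
    (Matrix.vecMulVec v (star v) *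
      Matrix.vecMulVec (phaseVector θ) (star (phaseVector θ))).trace =
      (((1 / (d : ℝ)) * ‖∑ ω, star (v ω) * Complex.exp (Complex.I * (θ ω : ℂ))‖ ^ 2 : ℝ) : ℂ) := by
  set s : ℂ := ∑ ω, star (v ω) * Complex.exp (Complex.I * (θ ω : ℂ)) with hs
  have h1 : star v ⬝ᵥ phaseVector θ = ((1 / Real.sqrt d : ℝ) : ℂ) * s := by
    simp only [dotProduct, phaseVector, hs, Finset.mul_sum, Pi.star_apply]
    exact Finset.sum_congr rfl fun ω _ => by ring
  have h2 : star (phaseVector θ) ⬝ᵥ v = star (((1 / Real.sqrt d : ℝ) : ℂ) * s) := by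
    rw [← h1, Matrix.star_dotProduct]
  have h4 : (1 / Real.sqrt d) * (1 / Real.sqrt d) = 1 / (d : ℝ) := by
    rw [div_mul_div_comm, one_mul, Real.mul_self_sqrt (Nat.cast_nonneg d)]
  rw [Matrix.vecMulVec_mul_vecMulVec, Matrix.trace_vecMulVec, dotProduct_smul, dotProduct_comm v,
    h1, h2, smul_eq_mul, star_mul']
  have h5 : s * star s = ((‖s‖ ^ 2 : ℝ) : ℂ) := by
    rw [Complex.star_def, Complex.mul_conj, Complex.normSq_eq_norm_sq]
  calc _ = (((1 / Real.sqrt d) * (1 / Real.sqrt d) : ℝ) : ℂ) * (s * star s) := by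
        rw [Complex.star_def, Complex.conj_ofReal]; push_cast; ring
    _ = _ := by rw [h4, h5]; push_cast; ring

/-- A positive semidefinite operator is a sum of rank-one ones, so that its expectations in
averages of phase vectors are sums of overlaps. -/
lemma exists_trace_eq_sum_meanOverlap {d K : ℕ} {E : Matrix (Fin d) (Fin d) ℂ}
    (hE : E.PosSemidef) :
    ∃ (n : ℕ) (c : Fin n → Fin d → ℂ),
      E.trace = ((∑ i, ∑ ω, ‖c i ω‖ ^ 2 : ℝ) : ℂ) ∧
      ∀ θ : Fin K → Fin d → ℝ,
        (E * ((1 / (K : ℂ)) • ∑ k : Fin K, Matrix.vecMulVec (phaseVector (θ k))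
          (star (phaseVector (θ k))))).trace =
        (((1 / (d : ℝ)) * ∑ i, meanOverlap (phases θ) (c i) : ℝ) : ℂ) := by
  obtain ⟨n, v, rfl⟩ := Matrix.posSemidef_iff_eq_sum_vecMulVec.mp hE
  refine ⟨n, fun i => star (v i), ?_, fun θ => ?_⟩
  · rw [Matrix.trace_sum]
    push_cast
    refine Finset.sum_congr rfl fun i _ => ?_
    rw [Matrix.trace_vecMulVec, dotProduct]
    refine Finset.sum_congr rfl fun ω _ => ?_
    rw [Pi.star_apply, Complex.star_def, Complex.mul_conj, Complex.normSq_eq_norm_sq,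
      Complex.norm_conj]
    push_cast; rfl
  · rw [Matrix.mul_smul, Matrix.trace_smul, Matrix.sum_mul, Matrix.trace_sum]
    simp only [Matrix.mul_sum, Matrix.trace_sum, trace_vecMulVec_mul_phaseVector, meanOverlap,
      phases, Pi.star_apply, smul_eq_mul]
    push_cast
    simp only [Finset.mul_sum]
    refine Finset.sum_congr rfl fun i _ => Finset.sum_congr rfl fun k _ => by ring

lemma trace_meanState {d K : ℕ} (hd : 0 < d) (hK : 0 < K) (θ : Fin K → Fin d → ℝ) :
    ((1 / (K : ℂ)) • ∑ k : Fin K, Matrix.vecMulVec (phaseVector (θ k))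
          (star (phaseVector (θ k)))).trace = 1 := by
  have h : ∀ k, (Matrix.vecMulVec (phaseVector (θ k)) (star (phaseVector (θ k)))).trace = 1 := by
    intro k
    have hd' : (d : ℂ) ≠ 0 := by exact_mod_cast hd.ne'
    rw [Matrix.trace_vecMulVec, dotProduct]
    have : ∀ ω, phaseVector (θ k) ω * star (phaseVector (θ k)) ω = 1 / (d : ℂ) := by
      intro ω
      rw [Pi.star_apply, Complex.star_def, Complex.mul_conj, Complex.normSq_eq_norm_sq,
        phaseVector, norm_mul, mul_comm Complex.I, Complex.norm_exp_ofReal_mul_I, mul_one,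
        Complex.norm_real, Real.norm_eq_abs, sq_abs, div_pow, Real.sq_sqrt (Nat.cast_nonneg d)]
      push_cast; ring
    rw [Finset.sum_congr rfl fun ω _ => this ω]
    simp [hd']
  have hK' : (K : ℂ) ≠ 0 := by exact_mod_cast hK.ne'
  rw [Matrix.trace_smul, Matrix.trace_sum, Finset.sum_congr rfl fun k _ => h k]
  simp [hK']

/-- The state is block diagonal in the message basis, so the measurement on `A` enters only through
its diagonal, which acts as a classical channel from `m` to `x`. -/
lemma outcomeProb_messageState {ι κ : Type*} [Fintype ι] [Fintype κ] {d M K : ℕ}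
    (ψ : Fin M → Fin K → Fin d → ℂ) (A : POVM ι (Fin M)) (E : POVM κ (Fin d)) (x : ι) (y : κ) :
    outcomeProb (messageState ψ) A E (x, y) =
      (1 / (M : ℝ)) * ∑ m, (A.effect x m m).re *
        (E.effect y * ((1 / (K : ℂ)) • ∑ k : Fin K, Matrix.vecMulVec (ψ m k)
          (star (ψ m k)))).trace.re := by
  have hA : ∀ m, (A.effect x m m).im = 0 := fun m =>
    (Complex.le_def.mp ((A.posSemidef x).diag_nonneg (i := m))).2.symm
  rw [outcomeProb, messageState, Matrix.mul_smul, Matrix.trace_smul, Matrix.mul_sum,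
    Matrix.trace_sum]
  simp only [← Matrix.mul_kronecker_mul, Matrix.trace_kronecker, Matrix.trace_mul_single]
  have : (1 / (M : ℂ)) = ((1 / (M : ℝ) : ℝ) : ℂ) := by push_cast; rfl
  rw [this, smul_eq_mul, Complex.re_ofReal_mul, Complex.re_sum]
  congr 1
  refine Finset.sum_congr rfl fun m _ => ?_
  simp [Complex.mul_re, hA]

/-- If for every direction the overlaps with the key averages are, for most messages, not much
below their mean value, then the messages are locked. -/
lemma mutualInfo_outcomeProb_le {ι κ : Type*} [Fintype ι] [Fintype κ] {d M K : ℕ} (hd : 0 < d)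
    (hM : 0 < M) (hK : 0 < K) (θ : Fin M → Fin K → Fin d → ℝ) {Δ : ℝ}
    (hΔ : ∀ c : Fin d → ℂ, ∑ m, max 0 (∑ ω, ‖c ω‖ ^ 2 - meanOverlap (phases (θ m)) c) ≤
      Δ * M * ∑ ω, ‖c ω‖ ^ 2) (A : POVM ι (Fin M)) (E : POVM κ (Fin d)) :
    mutualInfo (outcomeProb (messageState fun m k => phaseVector (θ m k)) A E) ≤
      3 * Real.logb 2 d * Δ := by
  have hM' : (0 : ℝ) < M := by exact_mod_cast hM
  have hd' : (0 : ℝ) < d := by exact_mod_cast hd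
  choose n c hc1 hc2 using fun y => exists_trace_eq_sum_meanOverlap (K := K) (E.posSemidef y)
  set a : Fin M → ι → ℝ := fun m x => (A.effect x m m).re with ha
  set q : Fin M → κ → ℝ := fun m y =>
    (1 / (d : ℝ)) * ∑ i, meanOverlap (phases (θ m)) (c y i) with hq
  set w : κ → ℝ := fun y => (1 / (d : ℝ)) * ∑ i, ∑ ω, ‖c y i ω‖ ^ 2 with hw
  have hp : ∀ x y, outcomeProb (messageState fun m k => phaseVector (θ m k)) A E (x, y) =
      (1 / (M : ℝ)) * ∑ m, a m x * q m y := by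
    intro x y
    rw [outcomeProb_messageState]
    simp only [hc2, Complex.ofReal_re, ha, hq]
  have ha0 : ∀ m x, 0 ≤ a m x := fun m x =>
    (Complex.le_def.mp ((A.posSemidef x).diag_nonneg (i := m))).1
  have hasum : ∀ m, ∑ x, a m x = 1 := by
    intro m
    have := congrArg (fun B : Matrix (Fin M) (Fin M) ℂ => (B m m).re) A.sum_effect
    simpa [Matrix.sum_apply] using this
  have hq0 : ∀ m y, 0 ≤ q m y := fun m y =>
    mul_nonneg (by positivity) (Finset.sum_nonneg fun i _ => meanOverlap_nonneg _ _)
  have hqsum : ∀ m, ∑ y, q m y = 1 := by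
    intro m
    have h1 : ((∑ y, q m y : ℝ) : ℂ) = 1 := by
      push_cast
      rw [Finset.sum_congr rfl fun y _ => (hc2 y (θ m)).symm, ← Matrix.trace_sum,
        ← Matrix.sum_mul, E.sum_effect, Matrix.one_mul, trace_meanState hd hK]
    exact_mod_cast h1
  have hw0 : ∀ y, 0 ≤ w y := fun y => by simp only [hw]; positivity
  have hwsum : ∑ y, w y = 1 := by
    have h1 : ((∑ y, ∑ i, ∑ ω, ‖c y i ω‖ ^ 2 : ℝ) : ℂ) = d := by
      rw [Complex.ofReal_sum, Finset.sum_congr rfl fun y _ => (hc1 y).symm, ← Matrix.trace_sum,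
        E.sum_effect, Matrix.trace_one, Fintype.card_fin]
    have h2 : ∑ y, ∑ i, ∑ ω, ‖c y i ω‖ ^ 2 = (d : ℝ) := by exact_mod_cast h1
    rw [← Finset.mul_sum, h2]; field_simp
  have hqw : ∀ m y, q m y ≤ d * w y := by
    intro m y
    simp only [hq, hw]
    rw [mul_left_comm, Finset.mul_sum (a := (d : ℝ))]
    gcongr with i
    exact meanOverlap_le hK (norm_phases _) _
  have hpx : ∀ x, ∑ y, outcomeProb (messageState fun m k => phaseVector (θ m k)) A E (x, y) =
      (1 / (M : ℝ)) * ∑ m, a m x := by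
    intro x
    simp only [hp, ← Finset.mul_sum]
    rw [Finset.sum_comm]
    simp only [← Finset.mul_sum, hqsum, mul_one]
  have key := mutualInfo_le_sum_max (D := (d : ℝ))
    (p := outcomeProb (messageState fun m k => phaseVector (θ m k)) A E) (w := w) ?_ ?_ hw0 ?_
    hwsum ?_
  · refine key.trans ?_
    have hlog : 0 ≤ 3 * Real.logb 2 d :=
      mul_nonneg (by norm_num) (Real.logb_nonneg (by norm_num) (by exact_mod_cast hd))
    refine mul_le_mul_of_nonneg_left ?_ hlog
    -- Convexity of the positive part moves the average over `m` outside; summing over `x` later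
    -- removes the channel `a` altogether.
    have hterm : ∀ x y, max 0 ((∑ y', outcomeProb (messageState fun m k => phaseVector (θ m k))
        A E (x, y')) * w y - outcomeProb (messageState fun m k => phaseVector (θ m k)) A E (x, y))
        ≤ (1 / (M : ℝ)) * ∑ m, a m x * max 0 (w y - q m y) := by
      intro x y
      rw [hpx, hp, mul_assoc, ← mul_sub, Finset.sum_mul, ← Finset.sum_sub_distrib]
      refine max_le (mul_nonneg (by positivity) (Finset.sum_nonneg fun m _ =>
        mul_nonneg (ha0 m x) (le_max_left _ _))) ?_
      gcongr with m
      rw [← mul_sub]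
      exact mul_le_mul_of_nonneg_left (le_max_right _ _) (ha0 m x)
    -- Subadditivity of the positive part reduces an effect to its rank-one pieces, each covered by
    -- `hΔ`.
    have hy : ∀ y, ∑ m, max 0 (w y - q m y) ≤ Δ * M * w y := by
      intro y
      have h1 : ∀ m, max 0 (w y - q m y) ≤ (1 / (d : ℝ)) *
          ∑ i, max 0 (∑ ω, ‖c y i ω‖ ^ 2 - meanOverlap (phases (θ m)) (c y i)) := by
        intro m
        refine max_le (mul_nonneg (by positivity) (Finset.sum_nonneg fun i _ =>
          le_max_left _ _)) ?_
        simp only [hw, hq]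
        rw [← mul_sub, ← Finset.sum_sub_distrib]
        gcongr with i
        exact le_max_right _ _
      calc ∑ m, max 0 (w y - q m y) ≤ ∑ m, (1 / (d : ℝ)) *
          ∑ i, max 0 (∑ ω, ‖c y i ω‖ ^ 2 - meanOverlap (phases (θ m)) (c y i)) :=
            Finset.sum_le_sum fun m _ => h1 m
        _ = (1 / (d : ℝ)) * ∑ i, ∑ m,
            max 0 (∑ ω, ‖c y i ω‖ ^ 2 - meanOverlap (phases (θ m)) (c y i)) := by
            rw [← Finset.mul_sum, Finset.sum_comm]
        _ ≤ (1 / (d : ℝ)) * ∑ i, Δ * M * ∑ ω, ‖c y i ω‖ ^ 2 := by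
            gcongr with i; exact hΔ _
        _ = Δ * M * w y := by rw [← Finset.mul_sum]; simp only [hw]; ring
    calc _ ≤ ∑ x, ∑ y, (1 / (M : ℝ)) * ∑ m, a m x * max 0 (w y - q m y) :=
          Finset.sum_le_sum fun x _ => Finset.sum_le_sum fun y _ => hterm x y
      _ = (1 / (M : ℝ)) * ∑ y, ∑ m, max 0 (w y - q m y) := by
          simp only [← Finset.mul_sum]
          congr 1
          rw [Finset.sum_comm]
          refine Finset.sum_congr rfl fun y _ => ?_
          rw [Finset.sum_comm]
          simp only [← Finset.sum_mul, hasum, one_mul]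
      _ ≤ (1 / (M : ℝ)) * ∑ y, Δ * M * w y := by gcongr with y; exact hy y
      _ = Δ := by rw [← Finset.mul_sum, hwsum]; field_simp
  · rcases Nat.lt_or_ge d 2 with h | h
    · left; have : d = 1 := by omega
      simp [this]
    · right; exact_mod_cast h
  · rintro ⟨x, y⟩
    rw [hp]
    exact mul_nonneg (by positivity) (Finset.sum_nonneg fun m _ => mul_nonneg (ha0 m x) (hq0 m y))
  · simp only [hpx, ← Finset.mul_sum]
    rw [Finset.sum_comm]
    simp [hasum, hM'.ne']
  · intro x y
    rw [hpx, hp]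
    calc (1 / (M : ℝ)) * ∑ m, a m x * q m y ≤ (1 / (M : ℝ)) * ∑ m, a m x * (d * w y) := by
          gcongr with m
          · exact ha0 m x
          · exact hqw m y
      _ = _ := by rw [← Finset.sum_mul]; ring

/-! ### Rounding to a lattice. -/

/-- Coordinates can be rounded to integers, one after the other, so that the errors do not add up
coherently. -/
lemma exists_int_sum_norm_sq_le {ι J : Type*} [Fintype ι] [Fintype J] (v : ι → J → ℂ)
    (x : ι → ℝ) :
    ∃ n : ι → ℤ, (∀ i, |x i - n i| ≤ 1) ∧
      ∑ j, ‖∑ i, ((x i - n i : ℝ) : ℂ) * v i j‖ ^ 2 ≤ (1 / 4) * ∑ i, ∑ j, ‖v i j‖ ^ 2 := by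
  classical
  suffices h : ∀ s : Finset ι, ∃ n : ι → ℤ, (∀ i, |x i - n i| ≤ 1) ∧
      ∑ j, ‖∑ i ∈ s, ((x i - n i : ℝ) : ℂ) * v i j‖ ^ 2 ≤
        (1 / 4) * ∑ i ∈ s, ∑ j, ‖v i j‖ ^ 2 from h Finset.univ
  intro s
  induction s using Finset.induction_on with
  | empty =>
    refine ⟨fun i => ⌊x i⌋, fun i => ?_, by simp⟩
    rw [Int.self_sub_floor, abs_of_nonneg (Int.fract_nonneg _)]
    exact (Int.fract_lt_one _).le
  | insert a s ha ih =>
    obtain ⟨n, hn1, hn2⟩ := ih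
    set S : J → ℂ := fun j => ∑ i ∈ s, ((x i - n i : ℝ) : ℂ) * v i j with hS
    set f := Int.fract (x a) with hf
    have hf0 : 0 ≤ f := Int.fract_nonneg _
    have hf1 : f < 1 := Int.fract_lt_one _
    set B := ∑ j, (S j * (starRingEnd ℂ) (v a j)).re with hB
    set N := ∑ j, ‖v a j‖ ^ 2 with hN
    have hQ : ∀ t : ℝ, ∑ j, ‖S j + (t : ℂ) * v a j‖ ^ 2 =
        ∑ j, ‖S j‖ ^ 2 + 2 * t * B + t ^ 2 * N := by
      intro t
      rw [hB, hN, Finset.mul_sum, Finset.mul_sum, ← Finset.sum_add_distrib,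
        ← Finset.sum_add_distrib]
      refine Finset.sum_congr rfl fun j _ => ?_
      rw [← Complex.normSq_eq_norm_sq, ← Complex.normSq_eq_norm_sq, ← Complex.normSq_eq_norm_sq,
        Complex.normSq_add, Complex.normSq_mul, Complex.normSq_ofReal, map_mul,
        Complex.conj_ofReal, mul_left_comm, Complex.re_ofReal_mul]
      ring
    have hstep : ∀ k : ℤ, |x a - k| ≤ 1 → 2 * (x a - k) * B + (x a - k) ^ 2 * N ≤ (1 / 4) * N →
        ∃ n : ι → ℤ, (∀ i, |x i - n i| ≤ 1) ∧
          ∑ j, ‖∑ i ∈ insert a s, ((x i - n i : ℝ) : ℂ) * v i j‖ ^ 2 ≤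
            (1 / 4) * ∑ i ∈ insert a s, ∑ j, ‖v i j‖ ^ 2 := by
      intro k hk1 hk2
      refine ⟨Function.update n a k, fun i => ?_, ?_⟩
      · rcases eq_or_ne i a with rfl | hi
        · simpa using hk1
        · simpa [hi] using hn1 i
      · have hsum : ∀ j, ∑ i ∈ insert a s, ((x i - (Function.update n a k i : ℤ) : ℝ) : ℂ) * v i j =
            S j + ((x a - k : ℝ) : ℂ) * v a j := by
          intro j
          rw [Finset.sum_insert ha, add_comm, Function.update_self]
          congr 1
          refine Finset.sum_congr rfl fun i hi => ?_
          rw [Function.update_of_ne (ne_of_mem_of_not_mem hi ha)]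
        simp only [hsum]
        rw [hQ, Finset.sum_insert ha, mul_add]
        linarith
    have hN0 : 0 ≤ N := by rw [hN]; positivity
    have hxf : x a = ⌊x a⌋ + f := (Int.floor_add_fract _).symm
    have hff : f * (1 - f) * N ≤ (1 / 4) * N :=
      mul_le_mul_of_nonneg_right (by nlinarith [sq_nonneg (2 * f - 1)]) hN0
    -- Weighting rounding down by `1 - f` and up by `f` cancels the cross term `B` and leaves `f (1
    -- - f) N ≤ N / 4`, so at least one of the two choices is good.
    by_cases hc : 2 * f * B + f ^ 2 * N ≤ (1 / 4) * N
    · refine hstep ⌊x a⌋ ?_ ?_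
      · rw [Int.self_sub_floor, abs_of_nonneg hf0]; exact hf1.le
      · rw [Int.self_sub_floor]; exact hc
    · have e : x a - ((⌊x a⌋ + 1 : ℤ) : ℝ) = f - 1 := by push_cast; linarith
      refine hstep (⌊x a⌋ + 1) ?_ ?_
      · rw [e, abs_le]; constructor <;> linarith
      · rw [e]
        push Not at hc
        by_contra hc2
        push Not at hc2
        have h1 := mul_lt_mul_of_pos_left hc (show 0 < 1 - f by linarith)
        have h2 := mul_le_mul_of_nonneg_left hc2.le hf0
        nlinarith

/-- The point of the lattice `h ℤ[i]^d` with integer coordinates `n`. -/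
noncomputable def latticePoint {d : ℕ} (h : ℝ) (n : Fin d ⊕ Fin d → ℤ) : Fin d → ℂ :=
  fun ω => (h : ℂ) * ((n (Sum.inl ω) : ℂ) + (n (Sum.inr ω) : ℂ) * Complex.I)

lemma sum_norm_latticePoint_sq {d : ℕ} (h : ℝ) (n : Fin d ⊕ Fin d → ℤ) :
    ∑ ω, ‖latticePoint h n ω‖ ^ 2 = h ^ 2 * ∑ i, (n i : ℝ) ^ 2 := by
  rw [Fintype.sum_sum_type, ← Finset.sum_add_distrib, Finset.mul_sum]
  refine Finset.sum_congr rfl fun ω _ => ?_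
  have : ((n (Sum.inl ω) : ℂ) + (n (Sum.inr ω) : ℂ) * Complex.I) =
      (((n (Sum.inl ω) : ℝ) : ℂ) + ((n (Sum.inr ω) : ℝ) : ℂ) * Complex.I) := by push_cast; rfl
  rw [latticePoint, this, norm_mul, mul_pow, Complex.norm_real, Real.norm_eq_abs, sq_abs,
    ← Complex.normSq_eq_norm_sq, Complex.normSq_add_mul_I]

/-- Rounding is applied to the `2d` real coordinates of `c / h`, whose columns `z` and `i z`,
indexed by all pairs `(m, k)`, have squared length `M K`. The averaged error `d h² / 2` is smaller
by a factor of order `d` than the worst-case bound on a vector of squared norm `2 d h²`. -/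
lemma exists_latticePoint_near {d M K : ℕ} (hK : 0 < K) {z : Fin M → Fin K → Fin d → ℂ}
    (hz : ∀ m k ω, ‖z m k ω‖ = 1) {h : ℝ} (hh : 0 < h) (c : Fin d → ℂ) :
    ∃ n : Fin d ⊕ Fin d → ℤ, ∑ ω, ‖c ω - latticePoint h n ω‖ ^ 2 ≤ 2 * d * h ^ 2 ∧
      ∑ m, meanOverlap (z m) (fun ω => c ω - latticePoint h n ω) ≤ M * (d * h ^ 2 / 2) := by
  have hK' : (0 : ℝ) < K := by exact_mod_cast hK
  have hhC : (h : ℂ) ≠ 0 := by exact_mod_cast hh.ne'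
  obtain ⟨n, hn1, hn2⟩ := exists_int_sum_norm_sq_le (J := Fin M × Fin K)
    (Sum.elim (fun ω j => z j.1 j.2 ω) (fun ω j => Complex.I * z j.1 j.2 ω))
    (Sum.elim (fun ω => (c ω).re / h) (fun ω => (c ω).im / h))
  have hu : ∀ ω, c ω - latticePoint h n ω =
      (h : ℂ) * ((((c ω).re / h - n (Sum.inl ω) : ℝ) : ℂ) +
        (((c ω).im / h - n (Sum.inr ω) : ℝ) : ℂ) * Complex.I) := by
    intro ω
    rw [latticePoint]
    nth_rewrite 1 [← Complex.re_add_im (c ω)]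
    push_cast
    field_simp
    ring
  refine ⟨n, ?_, ?_⟩
  · have : ∀ ω, ‖c ω - latticePoint h n ω‖ ^ 2 ≤ 2 * h ^ 2 := by
      intro ω
      have h1 := sq_le_one_iff_abs_le_one _ |>.mpr (hn1 (Sum.inl ω))
      have h2 := sq_le_one_iff_abs_le_one _ |>.mpr (hn1 (Sum.inr ω))
      simp only [Sum.elim_inl, Sum.elim_inr] at h1 h2
      rw [hu, norm_mul, mul_pow, Complex.norm_real, Real.norm_eq_abs, sq_abs,
        ← Complex.normSq_eq_norm_sq, Complex.normSq_add_mul_I]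
      nlinarith [sq_nonneg h]
    calc _ ≤ ∑ _ω : Fin d, 2 * h ^ 2 := Finset.sum_le_sum fun ω _ => this ω
      _ = _ := by rw [Finset.sum_const, Finset.card_univ, Fintype.card_fin, nsmul_eq_mul]; ring
  · have hS : ∀ m k, ‖∑ ω, (c ω - latticePoint h n ω) * z m k ω‖ ^ 2 = h ^ 2 *
        ‖∑ i, (((Sum.elim (fun ω => (c ω).re / h) (fun ω => (c ω).im / h) i) - n i : ℝ) : ℂ) *
          Sum.elim (fun ω (j : Fin M × Fin K) => z j.1 j.2 ω)
            (fun ω j => Complex.I * z j.1 j.2 ω) i (m, k)‖ ^ 2 := by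
      intro m k
      rw [Fintype.sum_sum_type, ← Finset.sum_add_distrib]
      simp only [Sum.elim_inl, Sum.elim_inr, hu]
      rw [← sq_abs h, ← Real.norm_eq_abs, ← Complex.norm_real, ← mul_pow, ← norm_mul,
        Finset.mul_sum]
      congr 2
      exact Finset.sum_congr rfl fun ω _ => by ring
    have hR : ∑ i, ∑ j, ‖Sum.elim (fun ω (j : Fin M × Fin K) => z j.1 j.2 ω)
            (fun ω j => Complex.I * z j.1 j.2 ω) i j‖ ^ 2 = 2 * d * (M * K) := by
      rw [Fintype.sum_sum_type]
      simp [hz]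
      ring
    rw [hR] at hn2
    simp only [meanOverlap, hS]
    rw [Fintype.sum_prod_type] at hn2
    simp only [← Finset.mul_sum]
    calc _ ≤ 1 / (K : ℝ) * (h ^ 2 * (1 / 4 * (2 * d * (M * K)))) := by gcongr
      _ = _ := by field_simp; ring

/-- Weighted Cauchy–Schwarz: `(x + y)² ≤ (1 + s)(x² + y² / s)`. -/
lemma norm_sq_div_le {s : ℝ} (hs : 0 < s) (a b : ℂ) :
    ‖b‖ ^ 2 / (1 + s) ≤ ‖a‖ ^ 2 + ‖a - b‖ ^ 2 / s := by
  have h1 : ‖b‖ ≤ ‖a‖ + ‖a - b‖ := by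
    calc ‖b‖ = ‖a - (a - b)‖ := by congr 1; ring
      _ ≤ _ := norm_sub_le _ _
  have h2 : ‖b‖ ^ 2 ≤ (‖a‖ + ‖a - b‖) ^ 2 := pow_le_pow_left₀ (norm_nonneg _) h1 2
  rw [div_le_iff₀ (by linarith)]
  have h3 : (‖a‖ ^ 2 + ‖a - b‖ ^ 2 / s) * (1 + s) - (‖a‖ + ‖a - b‖) ^ 2 =
      (s * ‖a‖ - ‖a - b‖) ^ 2 / s := by field_simp; ring
  have h4 : 0 ≤ (s * ‖a‖ - ‖a - b‖) ^ 2 / s := by positivity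
  linarith

lemma meanOverlap_div_le {d K : ℕ} (z : Fin K → Fin d → ℂ) {s : ℝ} (hs : 0 < s)
    (c c' : Fin d → ℂ) :
    meanOverlap z c' / (1 + s) ≤
      meanOverlap z c + meanOverlap z (fun ω => c ω - c' ω) / s := by
  unfold meanOverlap
  rw [mul_div_assoc, mul_div_assoc, ← mul_add, Finset.sum_div, Finset.sum_div,
    ← Finset.sum_add_distrib]
  gcongr with k
  refine (norm_sq_div_le hs (∑ ω, c ω * z k ω) _).trans_eq ?_
  rw [← Finset.sum_sub_distrib]
  simp only [sub_mul]

lemma max_one_sub_meanOverlap_le {d K : ℕ} (z : Fin K → Fin d → ℂ) {s : ℝ} (hs : 0 < s)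
    (c c' : Fin d → ℂ) :
    max 0 (1 - meanOverlap z c) ≤ max 0 (1 - meanOverlap z c') + s +
      meanOverlap z (fun ω => c ω - c' ω) / s := by
  have h0 := meanOverlap_nonneg z (fun ω => c ω - c' ω)
  have h1 := meanOverlap_div_le z hs c c'
  have h3 : 0 ≤ meanOverlap z (fun ω => c ω - c' ω) / s := by positivity
  have h4 := le_max_left 0 (1 - meanOverlap z c')
  have h5 := le_max_right 0 (1 - meanOverlap z c')
  refine max_le (by linarith) ?_
  have h2 : 1 - meanOverlap z c' / (1 + s) ≤ max 0 (1 - meanOverlap z c') + s := by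
    have : 1 - meanOverlap z c' / (1 + s) = (1 + s - meanOverlap z c') / (1 + s) := by
      field_simp
    rw [this, div_le_iff₀ (by linarith)]
    nlinarith
  linarith

/-! ### Counting lattice points in a ball. -/

lemma sum_exp_neg_abs_div_le {r : ℝ} (hr : 1 ≤ r) (T : ℕ) :
    ∑ k ∈ Finset.Icc (-(T : ℤ)) T, Real.exp (-(|(k : ℝ)| / r)) ≤ 4 * r := by
  have hr0 : 0 < r := by linarith
  set q := Real.exp (-(1 / r)) with hq
  have hq0 : 0 < q := Real.exp_pos _
  have hq1 : (1 + r) * (1 - q) ≥ 1 := by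
    have h1 : 1 / r + 1 ≤ Real.exp (1 / r) := Real.add_one_le_exp _
    have h2 : Real.exp (1 / r) * q = 1 := by rw [hq, ← Real.exp_add]; simp
    have h3 : (1 / r + 1) * q ≤ 1 := by
      exact (mul_le_mul_of_nonneg_right h1 hq0.le).trans_eq h2
    have h4 : (1 + r) * q ≤ r := by
      calc (1 + r) * q = r * ((1 / r + 1) * q) := by field_simp
        _ ≤ r * 1 := by gcongr
        _ = r := mul_one r
    linarith
  have hq2 : 0 < 1 - q := by
    by_contra h
    push Not at h
    nlinarith
  have hgeom : ∑ j ∈ Finset.range (T + 1), q ^ j ≤ 1 + r := by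
    have h1 : (∑ j ∈ Finset.range (T + 1), q ^ j) * (1 - q) = 1 - q ^ (T + 1) :=
      geom_sum_mul_neg _ _
    have h2 : 0 < q ^ (T + 1) := by positivity
    have h3 : (∑ j ∈ Finset.range (T + 1), q ^ j) * (1 - q) ≤ (1 + r) * (1 - q) := by linarith
    exact le_of_mul_le_mul_right h3 hq2
  have hexp : ∀ j : ℕ, Real.exp (-((j : ℝ) / r)) = q ^ j := by
    intro j
    rw [hq, ← Real.exp_nat_mul]; congr 1; ring
  have hsub : Finset.Icc (-(T : ℤ)) T ⊆
      (Finset.range (T + 1)).image (fun j : ℕ => (j : ℤ)) ∪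
        (Finset.range (T + 1)).image (fun j : ℕ => -(j : ℤ)) := by
    intro k hk
    rw [Finset.mem_Icc] at hk
    simp only [Finset.mem_union, Finset.mem_image, Finset.mem_range]
    rcases le_total 0 k with h | h
    · left; exact ⟨k.toNat, by omega, by omega⟩
    · right; exact ⟨(-k).toNat, by omega, by omega⟩
  have hle : ∑ k ∈ Finset.Icc (-(T : ℤ)) T, Real.exp (-(|(k : ℝ)| / r)) ≤
      ∑ j ∈ Finset.range (T + 1), q ^ j + ∑ j ∈ Finset.range (T + 1), q ^ j := by
    refine (Finset.sum_le_sum_of_subset_of_nonneg hsub fun _ _ _ => (Real.exp_pos _).le).trans ?_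
    refine (le_add_of_nonneg_right (Finset.sum_nonneg fun _ _ => (Real.exp_pos _).le)).trans_eq
      (Finset.sum_union_inter.trans ?_)
    rw [Finset.sum_image fun _ _ _ _ h => by exact_mod_cast h,
      Finset.sum_image fun _ _ _ _ h => by exact_mod_cast neg_injective h]
    simp [hexp]
  linarith

/-- A bound on the number of integer points of a ball of radius `r √N` in dimension `N`. -/
lemma card_filter_sum_sq_le {ι : Type*} [Fintype ι] [DecidableEq ι] {r : ℝ} (hr : 1 ≤ r)
    (T : ℕ) :
    (((Fintype.piFinset fun _ : ι => Finset.Icc (-(T : ℤ)) T).filter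
      (fun n => ∑ i, (n i : ℝ) ^ 2 ≤ Fintype.card ι * r ^ 2)).card : ℝ) ≤
      (Real.exp 1 * (4 * r)) ^ Fintype.card ι := by
  have hr0 : 0 < r := by linarith
  rw [Finset.card_eq_sum_ones]
  push_cast
  -- By `2 r |n_i| ≤ n_i² + r²`, points of the ball satisfy `∑ |n_i| / r ≤ N`, so each has weight at
  -- least 1; the total weight over the box factorizes. The box only ensures finiteness: its size
  -- does not enter the bound.
  calc _ ≤ ∑ n ∈ (Fintype.piFinset fun _ : ι => Finset.Icc (-(T : ℤ)) T).filter
        (fun n => ∑ i, (n i : ℝ) ^ 2 ≤ Fintype.card ι * r ^ 2),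
        ∏ i, (Real.exp 1 * Real.exp (-(|(n i : ℝ)| / r))) := by
        refine Finset.sum_le_sum fun n hn => ?_
        have hn2 := (Finset.mem_filter.mp hn).2
        simp only [← Real.exp_add]
        rw [← Real.exp_sum, Real.one_le_exp_iff, Finset.sum_add_distrib, Finset.sum_neg_distrib,
          Finset.sum_const, Finset.card_univ, nsmul_eq_mul, ← Finset.sum_div, mul_one,
          ← sub_eq_add_neg, sub_nonneg, div_le_iff₀ hr0]
        have h1 : ∀ i, |(n i : ℝ)| * (2 * r) ≤ (n i : ℝ) ^ 2 + r ^ 2 := fun i => by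
          nlinarith [sq_nonneg (|(n i : ℝ)| - r), sq_abs (n i : ℝ)]
        have h2 : (∑ i, |(n i : ℝ)|) * (2 * r) ≤ ∑ i, (n i : ℝ) ^ 2 + Fintype.card ι * r ^ 2 := by
          rw [Finset.sum_mul]
          refine (Finset.sum_le_sum fun i _ => h1 i).trans_eq ?_
          rw [Finset.sum_add_distrib, Finset.sum_const, Finset.card_univ, nsmul_eq_mul]
        refine le_of_mul_le_mul_right (a := 2 * r) ?_ (by linarith)
        nlinarith
    _ ≤ ∑ n ∈ (Fintype.piFinset fun _ : ι => Finset.Icc (-(T : ℤ)) T),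
        ∏ i, (Real.exp 1 * Real.exp (-(|(n i : ℝ)| / r))) :=
        Finset.sum_le_sum_of_subset_of_nonneg (Finset.filter_subset _ _) fun n _ _ =>
          Finset.prod_nonneg fun i _ => by positivity
    _ = ∏ _i : ι, ∑ k ∈ Finset.Icc (-(T : ℤ)) T,
          (Real.exp 1 * Real.exp (-(|(k : ℝ)| / r))) := by
        rw [Finset.prod_univ_sum]
    _ ≤ ∏ _i : ι, (Real.exp 1 * (4 * r)) := by
        refine Finset.prod_le_prod (fun i _ => by positivity) fun i _ => ?_
        rw [← Finset.mul_sum]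
        gcongr
        exact sum_exp_neg_abs_div_le hr T
    _ = _ := by rw [Finset.prod_const, Finset.card_univ]

/-! ### Moments, Laplace transforms and the Chernoff bound. -/

section Probability

variable {Ω : Type*} [MeasurableSpace Ω] {P : Measure Ω}

/-- Disjoint blocks of an independent family are independent. It serves twice: with one block per
key, then with one block per message. -/
lemma integral_prod_of_iIndepFun {J κ : Type*} [Finite κ] {X : J × κ → Ω → ℂ}
    (hX : iIndepFun X P) (mX : ∀ i, Measurable (X i)) {g : J → (κ → ℂ) → ℝ}
    (hg : ∀ j, Measurable (g j)) (s : Finset J) :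
    ∫ w, ∏ j ∈ s, g j (fun k => X (j, k) w) ∂P = ∏ j ∈ s, ∫ w, g j (fun k => X (j, k) w) ∂P := by
  classical
  have := hX.isProbabilityMeasure
  have := Fintype.ofFinite κ
  induction s using Finset.induction_on with
  | empty => simp
  | insert a s ha ih =>
    have hmem : ∀ j ∈ s, ∀ k : κ, (j, k) ∈ s ×ˢ (Finset.univ : Finset κ) := fun j hj k =>
      Finset.mem_product.mpr ⟨hj, Finset.mem_univ _⟩
    have hmem' : ∀ k : κ, (a, k) ∈ ({a} : Finset J) ×ˢ (Finset.univ : Finset κ) := fun k =>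
      Finset.mem_product.mpr ⟨Finset.mem_singleton_self a, Finset.mem_univ _⟩
    have hdisj : Disjoint (({a} : Finset J) ×ˢ (Finset.univ : Finset κ))
        (s ×ˢ (Finset.univ : Finset κ)) := by
      rw [Finset.disjoint_left]
      rintro ⟨j, k⟩ h1 h2
      have := Finset.mem_singleton.mp (Finset.mem_product.mp h1).1
      exact ha (this ▸ (Finset.mem_product.mp h2).1)
    have hind := (hX.indepFun_finset _ _ hdisj mX).comp
      (φ := fun y => g a (fun k => y ⟨(a, k), hmem' k⟩))
      (ψ := fun y => ∏ j ∈ s.attach, g j (fun k => y ⟨(j.1, k), hmem j.1 j.2 k⟩))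
      (by have := hg a; fun_prop)
      (Finset.measurable_fun_prod _ fun j _ => by have := hg j.1; fun_prop)
    have hind' : IndepFun (fun w => g a (fun k => X (a, k) w))
        (fun w => ∏ j ∈ s, g j (fun k => X (j, k) w)) P := by
      have e : (fun w => ∏ j ∈ s, g j (fun k => X (j, k) w)) =
          fun w => ∏ j ∈ s.attach, g j.1 (fun k => X (j.1, k) w) :=
        funext fun w => (Finset.prod_attach s (fun j => g j (fun k => X (j, k) w))).symm
      rw [e]
      exact hind
    simp only [Finset.prod_insert ha]
    rw [hind'.integral_fun_mul_eq_mul_integral, ih]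
    · exact Measurable.aestronglyMeasurable (by have := hg a; fun_prop)
    · exact (Finset.measurable_fun_prod _ fun j _ => by
        have := hg j; fun_prop).aestronglyMeasurable

/-- Second and fourth moments of a sum of independent centred variables of constant modulus. -/
lemma moments_sum_of_iIndepFun [IsProbabilityMeasure P] {ι : Type*} {X : ι → Ω → ℂ}
    (hX : iIndepFun X P) (mX : ∀ i, Measurable (X i)) {b : ι → ℝ} (hb : ∀ i w, ‖X i w‖ = b i)
    (h0 : ∀ i, ∫ w, X i w ∂P = 0) (s : Finset ι) :
    ∫ w, ‖∑ i ∈ s, X i w‖ ^ 2 ∂P = ∑ i ∈ s, b i ^ 2 ∧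
      ∫ w, ‖∑ i ∈ s, X i w‖ ^ 4 ∂P ≤ 3 * (∑ i ∈ s, b i ^ 2) ^ 2 := by
  classical
  induction s using Finset.induction_on with
  | empty => simp
  | insert a s ha ih =>
    obtain ⟨ih2, ih4⟩ := ih
    set S : Ω → ℂ := fun w => ∑ i ∈ s, X i w with hS
    have mS : Measurable S := Finset.measurable_fun_sum _ fun i _ => mX i
    have hSb : ∀ w, ‖S w‖ ≤ ∑ i ∈ s, b i := fun w =>
      (norm_sum_le _ _).trans_eq (Finset.sum_congr rfl fun i _ => hb i w)
    set B := ∑ i ∈ s, b i with hB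
    have hind : IndepFun S (X a) P := by
      have := hX.indepFun_finsetSum_of_notMem mX ha
      convert this using 1
      ext w
      simp [hS]
    have hcross : ∀ f : ℂ → ℂ, Measurable f → ∫ w, f (S w) * X a w ∂P = 0 := by
      intro f hf
      have := (hind.comp hf measurable_id).integral_fun_mul_eq_mul_integral
        (hf.comp mS).aestronglyMeasurable (mX a).aestronglyMeasurable
      simp only [Function.comp, id] at this
      rw [this, h0, mul_zero]
    set L : Ω → ℝ := fun w => 2 * ((starRingEnd ℂ) (S w) * X a w).re with hL
    have hexp : ∀ w, ‖∑ i ∈ insert a s, X i w‖ ^ 2 = ‖S w‖ ^ 2 + b a ^ 2 + L w := by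
      intro w
      rw [Finset.sum_insert ha, add_comm, ← hb a w, ← Complex.normSq_eq_norm_sq,
        ← Complex.normSq_eq_norm_sq, ← Complex.normSq_eq_norm_sq, Complex.normSq_add]
      simp only [hL, hS, Complex.mul_re, Complex.conj_re, Complex.conj_im]
      ring
    have hLb : ∀ w, L w ^ 2 ≤ 4 * b a ^ 2 * ‖S w‖ ^ 2 := by
      intro w
      have h1 : |((starRingEnd ℂ) (S w) * X a w).re| ≤ ‖S w‖ * b a := by
        refine (Complex.abs_re_le_norm _).trans_eq ?_
        rw [norm_mul, Complex.norm_conj, hb]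
      have h2 : ((starRingEnd ℂ) (S w) * X a w).re ^ 2 ≤ (‖S w‖ * b a) ^ 2 := by
        rw [← sq_abs]; exact pow_le_pow_left₀ (abs_nonneg _) h1 2
      simp only [hL]
      nlinarith
    have iS : ∀ n : ℕ, Integrable (fun w => ‖S w‖ ^ n) P := fun n =>
      Integrable.of_bound (by fun_prop) (B ^ n) (Filter.Eventually.of_forall fun w => by
        rw [Real.norm_eq_abs, abs_of_nonneg (by positivity)]
        exact pow_le_pow_left₀ (norm_nonneg _) (hSb w) n)
    have iSX : ∀ n : ℕ, Integrable
        (fun w => ((‖S w‖ : ℂ) ^ n * (starRingEnd ℂ) (S w)) * X a w) P := fun n =>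
      Integrable.of_bound (by have := mX a; fun_prop) (B ^ n * B * b a)
        (Filter.Eventually.of_forall fun w => by
          have hB0 : 0 ≤ B := (norm_nonneg _).trans (hSb w)
          rw [norm_mul, norm_mul, norm_pow, Complex.norm_conj, hb, Complex.norm_real, norm_norm]
          have := hb a w ▸ norm_nonneg (X a w)
          gcongr <;> exact hSb w)
    have iSL : ∀ n : ℕ, Integrable (fun w => ‖S w‖ ^ n * L w) P ∧
        ∫ w, ‖S w‖ ^ n * L w ∂P = 0 := by
      intro n
      have e : (fun w => ‖S w‖ ^ n * L w) = fun w =>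
          2 * (((‖S w‖ : ℂ) ^ n * (starRingEnd ℂ) (S w)) * X a w).re := by
        ext w
        have : ((‖S w‖ : ℂ) ^ n * (starRingEnd ℂ) (S w)) * X a w =
            ((‖S w‖ ^ n : ℝ) : ℂ) * ((starRingEnd ℂ) (S w) * X a w) := by push_cast; ring
        rw [this, Complex.re_ofReal_mul]
        simp only [hL]; ring
      have i1 : Integrable
          (fun w => (((‖S w‖ : ℂ) ^ n * (starRingEnd ℂ) (S w)) * X a w).re) P := (iSX n).re
      refine ⟨by rw [e]; exact i1.const_mul 2, ?_⟩
      rw [e, integral_const_mul]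
      have h1 := integral_re (𝕜 := ℂ) (iSX n)
      have h2 := hcross (fun u => (‖u‖ : ℂ) ^ n * (starRingEnd ℂ) u) (by fun_prop)
      simp only [RCLike.re_to_complex] at h1
      rw [h1, h2]; simp
    have iL : Integrable L P := by simpa using (iSL 0).1
    have zL : ∫ w, L w ∂P = 0 := by simpa using (iSL 0).2
    rw [Finset.sum_insert ha]
    set V := ∑ i ∈ s, b i ^ 2 with hV
    have hV0 : 0 ≤ V := Finset.sum_nonneg fun _ _ => sq_nonneg _
    constructor
    · simp only [hexp]
      have i0 : Integrable (fun w => ‖S w‖ ^ 2 + b a ^ 2) P := (iS 2).add (integrable_const _)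
      rw [integral_add i0 iL, integral_add (iS 2) (integrable_const _), ih2, zL]
      simp; ring
    -- Expand `(|S|² + b² + L)²` with `L` the cross term. Terms linear in `L` integrate to zero, and
    -- `L² ≤ 4 b² |S|²` raises the mixed coefficient from 2 to 6, exactly that of `3 (b² + V)²`.
    · have hle : ∀ w, ‖∑ i ∈ insert a s, X i w‖ ^ 4 ≤
          (‖S w‖ ^ 4 + 6 * b a ^ 2 * ‖S w‖ ^ 2 + b a ^ 4) +
            (2 * (‖S w‖ ^ 2 * L w) + 2 * b a ^ 2 * L w) := by
        intro w
        have : ‖∑ i ∈ insert a s, X i w‖ ^ 4 = (‖∑ i ∈ insert a s, X i w‖ ^ 2) ^ 2 := by ring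
        rw [this, hexp]
        nlinarith [hLb w]
      have i1 : Integrable (fun w => ‖S w‖ ^ 4 + 6 * b a ^ 2 * ‖S w‖ ^ 2) P :=
        (iS 4).add ((iS 2).const_mul _)
      have i2 : Integrable (fun w => ‖S w‖ ^ 4 + 6 * b a ^ 2 * ‖S w‖ ^ 2 + b a ^ 4) P :=
        i1.add (integrable_const _)
      have i3 : Integrable (fun w => 2 * (‖S w‖ ^ 2 * L w)) P := (iSL 2).1.const_mul 2
      have i4 : Integrable (fun w => 2 * b a ^ 2 * L w) P := iL.const_mul _
      have i5 : Integrable (fun w => 2 * (‖S w‖ ^ 2 * L w) + 2 * b a ^ 2 * L w) P := i3.add i4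
      have hval : ∫ w, ((‖S w‖ ^ 4 + 6 * b a ^ 2 * ‖S w‖ ^ 2 + b a ^ 4) +
            (2 * (‖S w‖ ^ 2 * L w) + 2 * b a ^ 2 * L w)) ∂P =
          ∫ w, ‖S w‖ ^ 4 ∂P + 6 * b a ^ 2 * V + b a ^ 4 := by
        rw [integral_add i2 i5, integral_add i3 i4, integral_add i1 (integrable_const _),
          integral_add (iS 4) ((iS 2).const_mul _), integral_const_mul, integral_const_mul,
          integral_const_mul, (iSL 2).2, zL, ih2]
        simp
      calc _ ≤ ∫ w, ((‖S w‖ ^ 4 + 6 * b a ^ 2 * ‖S w‖ ^ 2 + b a ^ 4) +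
            (2 * (‖S w‖ ^ 2 * L w) + 2 * b a ^ 2 * L w)) ∂P :=
            integral_mono_of_nonneg (Filter.Eventually.of_forall fun w => by positivity)
              (i2.add i5) (Filter.Eventually.of_forall hle)
        _ ≤ 3 * (b a ^ 2 + V) ^ 2 := by
            rw [hval]
            nlinarith [sq_nonneg (b a ^ 2)]

/-- `(1 - x + x²/2)(1 + x + x²/2) = 1 + x⁴/4 ≥ 1`, and the second factor is at most `exp x`. -/
lemma exp_neg_le_one_sub_add_sq {x : ℝ} (hx : 0 ≤ x) : Real.exp (-x) ≤ 1 - x + x ^ 2 / 2 := by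
  have h1 := Real.quadratic_le_exp_of_nonneg hx
  have h2 : Real.exp (-x) * Real.exp x = 1 := by rw [← Real.exp_add]; simp
  have h3 : Real.exp (-x) * (1 + x + x ^ 2 / 2) ≤ 1 :=
    (mul_le_mul_of_nonneg_left h1 (Real.exp_pos _).le).trans_eq h2
  have h4 : 1 ≤ (1 - x + x ^ 2 / 2) * (1 + x + x ^ 2 / 2) := by
    nlinarith [sq_nonneg (x ^ 2)]
  exact le_of_mul_le_mul_right (h3.trans h4) (by positivity)

/-- Laplace transform of the squared modulus of a random sum. -/
lemma integral_exp_neg_norm_sum_sq_le [IsProbabilityMeasure P] {ι : Type*} [Fintype ι]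
    {X : ι → Ω → ℂ} (hX : iIndepFun X P) (mX : ∀ i, Measurable (X i))
    (hb : ∀ i w, ‖X i w‖ = 1) (h0 : ∀ i, ∫ w, X i w ∂P = 0) (c : ι → ℂ) {l : ℝ} (hl : 0 ≤ l) :
    ∫ w, Real.exp (-(l * ‖∑ i, c i * X i w‖ ^ 2)) ∂P ≤
      Real.exp (-(l * ∑ i, ‖c i‖ ^ 2) + 3 / 2 * (l * ∑ i, ‖c i‖ ^ 2) ^ 2) := by
  obtain ⟨h2, h4⟩ := moments_sum_of_iIndepFun (X := fun i w => c i * X i w)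
    (hX.comp (fun i u => c i * u) fun i => by fun_prop) (fun i => (mX i).const_mul _)
    (b := fun i => ‖c i‖) (fun i w => by rw [norm_mul, hb, mul_one])
    (fun i => by rw [integral_const_mul, h0, mul_zero]) Finset.univ
  set V := ∑ i, ‖c i‖ ^ 2 with hV
  set S : Ω → ℂ := fun w => ∑ i, c i * X i w with hS
  have mS : Measurable S := Finset.measurable_fun_sum _ fun i _ => (mX i).const_mul _
  have iS : ∀ n : ℕ, Integrable (fun w => ‖S w‖ ^ n) P := fun n =>
    Integrable.of_bound (by fun_prop) ((∑ i, ‖c i‖) ^ n) (Filter.Eventually.of_forall fun w => by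
      rw [Real.norm_eq_abs, abs_of_nonneg (by positivity)]
      refine pow_le_pow_left₀ (norm_nonneg _) ((norm_sum_le _ _).trans_eq ?_) n
      simp only [norm_mul, hb, mul_one])
  have i1 : Integrable (fun w => 1 - l * ‖S w‖ ^ 2) P :=
    (integrable_const _).sub ((iS 2).const_mul _)
  have i2 : Integrable (fun w => l ^ 2 / 2 * ‖S w‖ ^ 4) P := (iS 4).const_mul _
  calc ∫ w, Real.exp (-(l * ‖S w‖ ^ 2)) ∂P
      ≤ ∫ w, ((1 - l * ‖S w‖ ^ 2) + l ^ 2 / 2 * ‖S w‖ ^ 4) ∂P := by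
        refine integral_mono_of_nonneg (Filter.Eventually.of_forall fun w => (Real.exp_pos _).le)
          (i1.add i2) (Filter.Eventually.of_forall fun w => ?_)
        refine (exp_neg_le_one_sub_add_sq (by positivity)).trans_eq ?_
        ring
    _ = 1 - l * V + l ^ 2 / 2 * ∫ w, ‖S w‖ ^ 4 ∂P := by
        rw [integral_add i1 i2, integral_sub (integrable_const _) ((iS 2).const_mul _),
          integral_const_mul, integral_const_mul, h2]
        simp
    _ ≤ (-(l * V) + 3 / 2 * (l * V) ^ 2) + 1 := by
        have := mul_le_mul_of_nonneg_left h4 (show 0 ≤ l ^ 2 / 2 by positivity)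
        linarith
    _ ≤ _ := Real.add_one_le_exp _

/-- Laplace transform of a mean overlap. -/
lemma integral_exp_neg_meanOverlap_le [IsProbabilityMeasure P] {d K : ℕ} (hK : 0 < K)
    {X : Fin K × Fin d → Ω → ℂ} (hX : iIndepFun X P) (mX : ∀ i, Measurable (X i))
    (hb : ∀ i w, ‖X i w‖ = 1) (h0 : ∀ i, ∫ w, X i w ∂P = 0) (c : Fin d → ℂ) {l : ℝ}
    (hl : 0 ≤ l) :
    ∫ w, Real.exp (-(l * (K * meanOverlap (fun k ω => X (k, ω) w) c))) ∂P ≤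
      Real.exp (K * (-(l * ∑ i, ‖c i‖ ^ 2) + 3 / 2 * (l * ∑ i, ‖c i‖ ^ 2) ^ 2)) := by
  have hK' : (K : ℝ) ≠ 0 := by exact_mod_cast hK.ne'
  have e : ∀ w, Real.exp (-(l * (K * meanOverlap (fun k ω => X (k, ω) w) c))) =
      ∏ k, Real.exp (-(l * ‖∑ ω, c ω * X (k, ω) w‖ ^ 2)) := by
    intro w
    rw [← Real.exp_sum, meanOverlap, Finset.sum_neg_distrib, ← Finset.mul_sum]
    congr 2
    field_simp
  simp only [e]
  rw [integral_prod_of_iIndepFun hX mX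
    (g := fun _ y => Real.exp (-(l * ‖∑ ω, c ω * y ω‖ ^ 2))) (fun _ => by fun_prop), Real.exp_nat_mul]
  calc _ ≤ ∏ _k : Fin K, Real.exp (-(l * ∑ i, ‖c i‖ ^ 2) + 3 / 2 * (l * ∑ i, ‖c i‖ ^ 2) ^ 2) := by
        refine Finset.prod_le_prod (fun k _ => integral_nonneg fun w => (Real.exp_pos _).le)
          fun k _ => ?_
        exact integral_exp_neg_norm_sum_sq_le (X := fun ω => X (k, ω))
          (hX.precomp (Prod.mk_right_injective k)) (fun ω => mX _) (fun ω => hb _)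
          (fun ω => h0 _) c hl
    _ = _ := by rw [Finset.prod_const, Finset.card_univ, Fintype.card_fin]

lemma measurable_meanOverlap {α : Type*} [MeasurableSpace α] {d K : ℕ}
    {X : Fin K × Fin d → α → ℂ} (mX : ∀ i, Measurable (X i)) (c : Fin d → ℂ) :
    Measurable fun w => meanOverlap (fun k ω => X (k, ω) w) c := by
  unfold meanOverlap
  fun_prop

lemma integral_exp_max_sub_meanOverlap_le [IsProbabilityMeasure P] {d K : ℕ} (hK : 0 < K)
    {X : Fin K × Fin d → Ω → ℂ} (hX : iIndepFun X P) (mX : ∀ i, Measurable (X i))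
    (hb : ∀ i w, ‖X i w‖ = 1) (h0 : ∀ i, ∫ w, X i w ∂P = 0) (c : Fin d → ℂ) {l : ℝ}
    (hl : 0 ≤ l) (τ : ℝ) :
    ∫ w, Real.exp (l * K * max 0 (τ - meanOverlap (fun k ω => X (k, ω) w) c)) ∂P ≤
      1 + Real.exp (K * (l * τ - l * ∑ i, ‖c i‖ ^ 2 + 3 / 2 * (l * ∑ i, ‖c i‖ ^ 2) ^ 2)) := by
  set O : Ω → ℝ := fun w => meanOverlap (fun k ω => X (k, ω) w) c with hO
  have mO : Measurable O := measurable_meanOverlap mX c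
  have O0 : ∀ w, 0 ≤ O w := fun w => meanOverlap_nonneg _ c
  have hL : ∫ w, Real.exp (-(l * (K * O w))) ∂P ≤ _ :=
    integral_exp_neg_meanOverlap_le hK hX mX hb h0 c hl
  have iE : Integrable (fun w => Real.exp (-(l * (K * O w)))) P :=
    Integrable.of_bound (by fun_prop) 1 (Filter.Eventually.of_forall fun w => by
      have := O0 w
      rw [Real.norm_eq_abs, abs_of_pos (Real.exp_pos _), Real.exp_le_one_iff, neg_nonpos]
      positivity)
  calc ∫ w, Real.exp (l * K * max 0 (τ - O w)) ∂P
      ≤ ∫ w, (1 + Real.exp (l * K * τ) * Real.exp (-(l * (K * O w)))) ∂P := by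
        refine integral_mono_of_nonneg (Filter.Eventually.of_forall fun w =>
          (Real.exp_pos _).le) ((integrable_const _).add (iE.const_mul _))
          (Filter.Eventually.of_forall fun w => ?_)
        have e2 : Real.exp (l * K * τ) * Real.exp (-(l * (K * O w))) =
            Real.exp (l * K * (τ - O w)) := by
          rw [← Real.exp_add]; congr 1; ring
        dsimp only
        rw [e2]
        have := Real.exp_pos (l * K * (τ - O w))
        rcases max_choice 0 (τ - O w) with h | h
        · rw [h, mul_zero, Real.exp_zero]; linarith
        · rw [h]; linarith
    _ = 1 + Real.exp (l * K * τ) * ∫ w, Real.exp (-(l * (K * O w))) ∂P := by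
        rw [integral_add (integrable_const _) (iE.const_mul _), integral_const_mul]
        simp
    _ ≤ 1 + Real.exp (l * K * τ) * Real.exp
        (K * (-(l * ∑ i, ‖c i‖ ^ 2) + 3 / 2 * (l * ∑ i, ‖c i‖ ^ 2) ^ 2)) := by gcongr
    _ = _ := by rw [← Real.exp_add]; congr 2; ring

/-- Lower tail of the mean overlaps with a fixed direction, added up over the messages. -/
lemma measureReal_sum_max_sub_meanOverlap_ge_le [IsProbabilityMeasure P] {d M K : ℕ} (hM : 0 < M)
    (hK : 0 < K) {X : Fin M × Fin K × Fin d → Ω → ℂ} (hX : iIndepFun X P)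
    (mX : ∀ i, Measurable (X i)) (hb : ∀ i w, ‖X i w‖ = 1) (h0 : ∀ i, ∫ w, X i w ∂P = 0)
    (c : Fin d → ℂ) {l τ : ℝ} (hl : 0 ≤ l)
    (hτ : K * (l * τ - l * ∑ i, ‖c i‖ ^ 2 + 3 / 2 * (l * ∑ i, ‖c i‖ ^ 2) ^ 2) ≤ -Real.log M)
    (a : ℝ) :
    P.real {w | a ≤ ∑ m, max 0 (τ - meanOverlap (fun k ω => X (m, k, ω) w) c)} ≤
      Real.exp (1 - l * K * a) := by
  have hM' : (0 : ℝ) < M := by exact_mod_cast hM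
  have hK' : (0 : ℝ) < K := by exact_mod_cast hK
  set F : Ω → ℝ := fun w => ∑ m, max 0 (τ - meanOverlap (fun k ω => X (m, k, ω) w) c) with hF
  have mO : ∀ m, Measurable fun w => meanOverlap (fun k ω => X (m, k, ω) w) c := fun m =>
    measurable_meanOverlap (X := fun i => X (m, i)) (fun i => mX _) c
  have mF : Measurable F := by
    simp only [hF]; fun_prop
  have hFb : ∀ w, ‖F w‖ ≤ M * max 0 τ := by
    intro w
    rw [Real.norm_eq_abs, abs_of_nonneg (Finset.sum_nonneg fun m _ => le_max_left _ _)]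
    calc F w ≤ ∑ _m : Fin M, max 0 τ := Finset.sum_le_sum fun m _ =>
          max_le_max le_rfl (by linarith [meanOverlap_nonneg (fun k ω => X (m, k, ω) w) c])
      _ = _ := by simp
  have hlK : 0 ≤ l * K := by positivity
  have iF : Integrable (fun w => Real.exp (l * K * F w)) P :=
    Integrable.of_bound (by fun_prop) (Real.exp (l * K * (M * max 0 τ)))
      (Filter.Eventually.of_forall fun w => by
        rw [Real.norm_eq_abs, abs_of_pos (Real.exp_pos _)]
        gcongr
        exact (le_abs_self _).trans (hFb w))
  have hmgf : mgf F P (l * K) ≤ Real.exp 1 := by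
    have e : ∀ w, Real.exp (l * K * F w) = ∏ m,
        Real.exp (l * K * max 0 (τ - meanOverlap (fun k ω => X (m, k, ω) w) c)) := by
      intro w
      rw [← Real.exp_sum, ← Finset.mul_sum]
    simp only [mgf, e]
    rw [integral_prod_of_iIndepFun hX mX
      (g := fun _ y => Real.exp (l * K * max 0 (τ - meanOverlap (fun k ω => y (k, ω)) c)))
      (fun _ => by
        have := measurable_meanOverlap (K := K) (X := fun i (y : Fin K × Fin d → ℂ) => y i)
          (fun i => measurable_pi_apply i) c
        fun_prop)]
    -- `hτ` makes each factor at most `1 + 1/M`, so that the product over `M` messages stays below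
    -- `e`.
    have h1 : ∀ m, ∫ w, Real.exp (l * K * max 0 (τ - meanOverlap (fun k ω => X (m, k, ω) w) c)) ∂P
        ≤ Real.exp (1 / M) := by
      intro m
      calc _ ≤ 1 + Real.exp (K * (l * τ - l * ∑ i, ‖c i‖ ^ 2 + 3 / 2 * (l * ∑ i, ‖c i‖ ^ 2) ^ 2)) :=
            integral_exp_max_sub_meanOverlap_le (X := fun i => X (m, i)) hK
              (hX.precomp (Prod.mk_right_injective m)) (fun i => mX _) (fun i => hb _)
              (fun i => h0 _) c hl τ
        _ ≤ 1 + Real.exp (-Real.log M) := by gcongr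
        _ = 1 / M + 1 := by rw [Real.exp_neg, Real.exp_log hM']; ring
        _ ≤ _ := Real.add_one_le_exp _
    calc _ ≤ ∏ _m : Fin M, Real.exp (1 / M) :=
          Finset.prod_le_prod (fun m _ => integral_nonneg fun w => (Real.exp_pos _).le)
            fun m _ => h1 m
      _ = Real.exp 1 := by
          rw [Finset.prod_const, Finset.card_univ, Fintype.card_fin, ← Real.exp_nat_mul]
          congr 1; field_simp
  calc P.real {w | a ≤ F w} ≤ Real.exp (-(l * K) * a) * mgf F P (l * K) :=
        measure_ge_le_exp_mul_mgf a hlK iF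
    _ ≤ Real.exp (-(l * K) * a) * Real.exp 1 := by gcongr
    _ = _ := by rw [← Real.exp_add]; congr 1; ring

end Probability

/-! ### Reduction to unit vectors and union bound over the net. -/

lemma meanOverlap_ofReal_mul {d K : ℕ} (z : Fin K → Fin d → ℂ) (t : ℝ) (c : Fin d → ℂ) :
    meanOverlap z (fun ω => (t : ℂ) * c ω) = t ^ 2 * meanOverlap z c := by
  have : ∀ k, ‖∑ ω, (t : ℂ) * c ω * z k ω‖ ^ 2 = t ^ 2 * ‖∑ ω, c ω * z k ω‖ ^ 2 := by
    intro k
    simp only [mul_assoc]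
    rw [← Finset.mul_sum, norm_mul, mul_pow, Complex.norm_real, Real.norm_eq_abs, sq_abs]
  simp only [meanOverlap, this, ← Finset.mul_sum]
  ring

lemma sum_max_sub_meanOverlap_le_of_unit {d M K : ℕ} {z : Fin M → Fin K → Fin d → ℂ} {Δ : ℝ}
    (h : ∀ c : Fin d → ℂ, ∑ ω, ‖c ω‖ ^ 2 = 1 → ∑ m, max 0 (1 - meanOverlap (z m) c) ≤ Δ * M)
    (c : Fin d → ℂ) :
    ∑ m, max 0 (∑ ω, ‖c ω‖ ^ 2 - meanOverlap (z m) c) ≤ Δ * M * ∑ ω, ‖c ω‖ ^ 2 := by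
  set v := ∑ ω, ‖c ω‖ ^ 2 with hv
  have hv0 : 0 ≤ v := Finset.sum_nonneg fun _ _ => sq_nonneg _
  rcases hv0.eq_or_lt with hv0 | hv0
  · rw [← hv0, mul_zero]
    refine Finset.sum_nonpos fun m _ => max_le le_rfl ?_
    linarith [meanOverlap_nonneg (z m) c]
  · have hs : (Real.sqrt v)⁻¹ ^ 2 = v⁻¹ := by rw [inv_pow, Real.sq_sqrt hv0.le]
    have h1 := h (fun ω => (((Real.sqrt v)⁻¹ : ℝ) : ℂ) * c ω) (by
      simp only [norm_mul, mul_pow, Complex.norm_real, Real.norm_eq_abs, sq_abs, hs,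
        ← Finset.mul_sum]
      exact inv_mul_cancel₀ hv0.ne')
    simp only [meanOverlap_ofReal_mul, hs] at h1
    calc ∑ m, max 0 (v - meanOverlap (z m) c)
        = (∑ m, max 0 (1 - v⁻¹ * meanOverlap (z m) c)) * v := by
          rw [Finset.sum_mul]
          refine Finset.sum_congr rfl fun m _ => ?_
          rw [max_mul_of_nonneg _ _ hv0.le, zero_mul]
          congr 1
          field_simp
      _ ≤ Δ * M * v := by gcongr

lemma accessibleInfo_messageState_le {d M K : ℕ} (hd : 0 < d) (hM : 0 < M) (hK : 0 < K)
    (θ : Fin M → Fin K → Fin d → ℝ) {Δ : ℝ}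
    (h : ∀ c : Fin d → ℂ, ∑ ω, ‖c ω‖ ^ 2 = 1 →
      ∑ m, max 0 (1 - meanOverlap (phases (θ m)) c) ≤ Δ * M) :
    accessibleInfo (messageState fun m k => phaseVector (θ m k)) ≤
      ((3 * Real.logb 2 d * Δ : ℝ) : EReal) := by
  refine iSup_le fun I => iSup_le fun J => iSup_le fun A => iSup_le fun E => ?_
  exact EReal.coe_le_coe_iff.mpr
    (mutualInfo_outcomeProb_le hd hM hK θ (sum_max_sub_meanOverlap_le_of_unit h) A E)

/-- Every unit vector is close, for the average over all codewords, to a lattice point from a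
finite set that does not depend on the codewords. -/
lemma sum_max_one_sub_meanOverlap_le_of_net {d M K : ℕ} (hd : 0 < d) (hK : 0 < K)
    {z : Fin M → Fin K → Fin d → ℂ} (hz : ∀ m k ω, ‖z m k ω‖ = 1) {δ B : ℝ} (hδ : 0 < δ)
    (hδ1 : δ ≤ 1) {T : ℕ} (hT : (2 * d : ℝ) * (2 / δ) ^ 2 ≤ T)
    (h : ∀ n ∈ (Fintype.piFinset fun _ : Fin d ⊕ Fin d => Finset.Icc (-(T : ℤ)) T).filter
        (fun n => ∑ i, (n i : ℝ) ^ 2 ≤ Fintype.card (Fin d ⊕ Fin d) * (2 / δ) ^ 2),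
      (∑ ω, ‖latticePoint (δ / Real.sqrt (2 * d)) n ω‖ ^ 2 ≤ 4 →
       1 - 2 * δ ≤ ∑ ω, ‖latticePoint (δ / Real.sqrt (2 * d)) n ω‖ ^ 2 →
        ∑ m, max 0 (1 - meanOverlap (z m) (latticePoint (δ / Real.sqrt (2 * d)) n)) ≤ B))
    (c : Fin d → ℂ) (hc : ∑ ω, ‖c ω‖ ^ 2 = 1) :
    ∑ m, max 0 (1 - meanOverlap (z m) c) ≤ B + 2 * δ * M := by
  have hd' : (0 : ℝ) < d := by exact_mod_cast hd
  set e := δ / Real.sqrt (2 * d) with he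
  have he0 : 0 < e := by positivity
  -- The mesh makes the rounding error at most `δ` in norm and `δ² / 4` in averaged overlap;
  -- division by `s = δ` turns the latter into `δ / 4`.
  have he2 : 2 * d * e ^ 2 = δ ^ 2 := by
    rw [he, div_pow, Real.sq_sqrt (by positivity)]; field_simp
  obtain ⟨n, hn1, hn2⟩ := exists_latticePoint_near hK hz he0 c
  rw [he2] at hn1
  have hM0 : (0 : ℝ) ≤ M := Nat.cast_nonneg M
  have hle : ∑ ω, ‖latticePoint e n ω‖ ^ 2 ≤ 4 := by
    have h1 : (∑ ω, ‖latticePoint e n ω‖ ^ 2) / (1 + 1) ≤ 1 + δ ^ 2 / 1 := by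
      rw [Finset.sum_div]
      refine (Finset.sum_le_sum fun ω _ => norm_sq_div_le one_pos (c ω) _).trans ?_
      rw [Finset.sum_add_distrib, hc, ← Finset.sum_div]
      gcongr
    nlinarith
  have hge : 1 - 2 * δ ≤ ∑ ω, ‖latticePoint e n ω‖ ^ 2 := by
    have h1 : 1 / (1 + δ) ≤ (∑ ω, ‖latticePoint e n ω‖ ^ 2) + δ ^ 2 / δ := by
      have h0 : 1 / (1 + δ) = ∑ ω, ‖c ω‖ ^ 2 / (1 + δ) := by rw [← Finset.sum_div, hc]
      rw [h0]
      refine (Finset.sum_le_sum fun ω _ =>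
        norm_sq_div_le hδ (latticePoint e n ω) (c ω)).trans ?_
      rw [Finset.sum_add_distrib, ← Finset.sum_div]
      simp only [norm_sub_rev (latticePoint e n _)]
      gcongr
    have h2 : 1 - δ ≤ 1 / (1 + δ) := by
      rw [le_div_iff₀ (by linarith)]; nlinarith
    have h3 : δ ^ 2 / δ = δ := by field_simp
    linarith
  have hsum : ∑ i, (n i : ℝ) ^ 2 ≤ 2 * d * (2 / δ) ^ 2 := by
    have h1 := sum_norm_latticePoint_sq e n
    have h2 : e ^ 2 * ∑ i, (n i : ℝ) ^ 2 ≤ e ^ 2 * (2 * d * (2 / δ) ^ 2) := by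
      rw [← h1]
      refine hle.trans_eq ?_
      calc (4 : ℝ) = δ ^ 2 * (2 / δ) ^ 2 := by field_simp; norm_num
        _ = _ := by rw [← he2]; ring
    exact le_of_mul_le_mul_left h2 (by positivity)
  have hmem : n ∈ (Fintype.piFinset fun _ : Fin d ⊕ Fin d => Finset.Icc (-(T : ℤ)) T).filter
        (fun n => ∑ i, (n i : ℝ) ^ 2 ≤ Fintype.card (Fin d ⊕ Fin d) * (2 / δ) ^ 2) := by
    rw [Finset.mem_filter]
    constructor
    · rw [Fintype.mem_piFinset]
      intro i
      -- For integers `|n_i| ≤ n_i²`, so no square root is needed in the size of the box.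
      have h1 : (n i : ℝ) ^ 2 ≤ T :=
        (Finset.single_le_sum (f := fun i => (n i : ℝ) ^ 2) (fun i _ => sq_nonneg _)
          (Finset.mem_univ i)).trans (hsum.trans hT)
      have h2 : n i ^ 2 ≤ (T : ℤ) := by exact_mod_cast h1
      rw [Finset.mem_Icc]
      constructor <;> nlinarith [Int.le_self_sq (n i), Int.le_self_sq (-(n i))]
    · simp only [Fintype.card_sum, Fintype.card_fin]
      push_cast
      linarith
  have hB := h n hmem hle hge
  calc ∑ m, max 0 (1 - meanOverlap (z m) c)
      ≤ ∑ m, (max 0 (1 - meanOverlap (z m) (latticePoint e n)) + δ +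
          meanOverlap (z m) (fun ω => c ω - latticePoint e n ω) / δ) :=
        Finset.sum_le_sum fun m _ => max_one_sub_meanOverlap_le (z m) hδ c _
    _ = ∑ m, max 0 (1 - meanOverlap (z m) (latticePoint e n)) + M * δ +
          (∑ m, meanOverlap (z m) (fun ω => c ω - latticePoint e n ω)) / δ := by
        rw [Finset.sum_add_distrib, Finset.sum_add_distrib, Finset.sum_div]; simp
    _ ≤ B + M * δ + M * (d * e ^ 2 / 2) / δ := by gcongr
    _ = B + M * δ + M * (δ / 4) := by
        have : d * e ^ 2 / 2 = δ ^ 2 / 4 := by linarith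
        rw [this]; field_simp
    _ ≤ _ := by nlinarith [mul_nonneg hM0 hδ.le]

/-- Locking for small `δ`: outside an event of small probability the overlaps with all unit vectors
are, for most messages, not much below their mean. -/
lemma exists_net_bound {Ω : Type*} [MeasurableSpace Ω] {P : Measure Ω} [IsProbabilityMeasure P]
    {d M K : ℕ} (hd : 0 < d) (hM : 0 < M) (hK : 0 < K)
    {X : Fin M × Fin K × Fin d → Ω → ℂ} (hX : iIndepFun X P)
    (mX : ∀ i, Measurable (X i)) (hb : ∀ i w, ‖X i w‖ = 1) (h0 : ∀ i, ∫ w, X i w ∂P = 0)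
    {δ : ℝ} (hδ : 0 < δ) (hδ1 : δ ≤ 1) (hKM : 4 * Real.log M ≤ K * δ ^ 2) :
    P.real {w | ¬ ∀ c : Fin d → ℂ, ∑ ω, ‖c ω‖ ^ 2 = 1 →
      ∑ m, max 0 (1 - meanOverlap (fun k ω => X (m, k, ω) w) c) ≤ 30 * δ * M} ≤
      (Real.exp 1 * (8 / δ)) ^ (2 * d) * Real.exp (1 - δ ^ 2 * K * M) := by
  have hd' : (0 : ℝ) < d := by exact_mod_cast hd
  have hM' : (0 : ℝ) < M := by exact_mod_cast hM
  have hK' : (0 : ℝ) < K := by exact_mod_cast hK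
  set e := δ / Real.sqrt (2 * d) with he
  set T : ℕ := ⌈(2 * d : ℝ) * (2 / δ) ^ 2⌉₊ with hT
  set S := (Fintype.piFinset fun _ : Fin d ⊕ Fin d => Finset.Icc (-(T : ℤ)) T).filter
        (fun n => ∑ i, (n i : ℝ) ^ 2 ≤ Fintype.card (Fin d ⊕ Fin d) * (2 / δ) ^ 2) with hS
  -- The deterministic norm conditions make the event empty at lattice points that approximate no
  -- unit vector.
  set bad : (Fin d ⊕ Fin d → ℤ) → Set Ω := fun n =>
    {w | ∑ ω, ‖latticePoint e n ω‖ ^ 2 ≤ 4 ∧ 1 - 2 * δ ≤ ∑ ω, ‖latticePoint e n ω‖ ^ 2 ∧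
      δ * M ≤ ∑ m, max 0 (1 - 27 * δ - meanOverlap (fun k ω => X (m, k, ω) w)
        (latticePoint e n))} with hbad
  have hsub : {w | ¬ ∀ c : Fin d → ℂ, ∑ ω, ‖c ω‖ ^ 2 = 1 →
      ∑ m, max 0 (1 - meanOverlap (fun k ω => X (m, k, ω) w) c) ≤ 30 * δ * M} ⊆
      ⋃ n ∈ S, bad n := by
    intro w hw
    by_contra hnot
    simp only [Set.mem_iUnion, not_exists] at hnot
    refine hw fun c hc => ?_
    have := sum_max_one_sub_meanOverlap_le_of_net (z := fun m k ω => X (m, k, ω) w) hd hK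
      (fun m k ω => hb _ w) (B := 28 * δ * M) hδ hδ1 (T := T) (Nat.le_ceil _) ?_ c hc
    · linarith
    · intro n hn h4 h1
      have hlt : ∑ m, max 0 (1 - 27 * δ - meanOverlap (fun k ω => X (m, k, ω) w)
          (latticePoint e n)) < δ * M := by
        by_contra hcon
        exact hnot n hn ⟨h4, h1, not_lt.mp hcon⟩
      calc ∑ m, max 0 (1 - meanOverlap (fun k ω => X (m, k, ω) w) (latticePoint e n))
          ≤ ∑ m, (max 0 (1 - 27 * δ - meanOverlap (fun k ω => X (m, k, ω) w)
              (latticePoint e n)) + 27 * δ) := by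
            refine Finset.sum_le_sum fun m _ => max_le (by positivity) ?_
            have := le_max_right 0 (1 - 27 * δ - meanOverlap (fun k ω => X (m, k, ω) w)
              (latticePoint e n))
            linarith
        _ ≤ 28 * δ * M := by
            rw [Finset.sum_add_distrib]
            simp only [Finset.sum_const, Finset.card_univ, Fintype.card_fin, nsmul_eq_mul]
            linarith
  have hone : ∀ n, P.real (bad n) ≤ Real.exp (1 - δ ^ 2 * K * M) := by
    intro n
    by_cases hv : ∑ ω, ‖latticePoint e n ω‖ ^ 2 ≤ 4 ∧
        1 - 2 * δ ≤ ∑ ω, ‖latticePoint e n ω‖ ^ 2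
    · obtain ⟨hv4, hv1⟩ := hv
      refine (measureReal_mono fun w hw => hw.2.2).trans
        ((measureReal_sum_max_sub_meanOverlap_ge_le hM hK hX mX hb h0 (latticePoint e n)
          (l := δ) (τ := 1 - 27 * δ) hδ.le ?_ (δ * M)).trans_eq (by congr 1; ring))
      set v := ∑ ω, ‖latticePoint e n ω‖ ^ 2 with hvdef
      have hv0 : 0 ≤ v := Finset.sum_nonneg fun _ _ => sq_nonneg _
      have h1 : v ^ 2 ≤ 16 := by nlinarith
      -- 27 = 2 + 24 + 1: the loss in `v ≥ 1 - 2δ`, the quadratic term `3/2 · 16`, and the remaining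
      -- margin `δ²` that pays for `log M / K`. The final 30 adds 1 for the Chernoff threshold and 2
      -- for rounding.
      have h2 : δ * (1 - 27 * δ) - δ * v + 3 / 2 * (δ * v) ^ 2 ≤ - δ ^ 2 := by
        have h3 := mul_le_mul_of_nonneg_left h1 (sq_nonneg δ)
        have h4 := mul_le_mul_of_nonneg_left hv1 hδ.le
        nlinarith
      have h5 := mul_le_mul_of_nonneg_left h2 hK'.le
      have h6 : 0 ≤ Real.log M := Real.log_natCast_nonneg M
      linarith
    · have : bad n = ∅ := by
        ext w
        simp only [hbad, Set.mem_ofPred_eq, Set.mem_empty_iff_false, iff_false]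
        exact fun h => hv ⟨h.1, h.2.1⟩
      rw [this, measureReal_empty]
      exact (Real.exp_pos _).le
  have hcard : (S.card : ℝ) ≤ (Real.exp 1 * (8 / δ)) ^ (2 * d) := by
    have h1 : (1 : ℝ) ≤ 2 / δ := by rw [le_div_iff₀ hδ]; linarith
    refine (card_filter_sum_sq_le (ι := Fin d ⊕ Fin d) h1 T).trans_eq ?_
    rw [Fintype.card_sum, Fintype.card_fin, ← two_mul]
    congr 2
    ring
  -- Monotonicity and subadditivity hold for arbitrary sets, so measurability of the failure event
  -- is not needed.
  calc _ ≤ P.real (⋃ n ∈ S, bad n) := measureReal_mono hsub (measure_ne_top _ _)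
    _ ≤ ∑ n ∈ S, P.real (bad n) := measureReal_biUnion_finset_le _ _
    _ ≤ ∑ _n ∈ S, Real.exp (1 - δ ^ 2 * K * M) := Finset.sum_le_sum fun n _ => hone n
    _ = S.card * Real.exp (1 - δ ^ 2 * K * M) := by rw [Finset.sum_const, nsmul_eq_mul]
    _ ≤ _ := by gcongr

/-- Since `8e ≤ 25`, the net has at most `exp (4 d L)` points. Positivity of the exponent gives `2 d
L < δ³ K M / 4`, and `1 ≤ d L`; so the surplus `2 d L + 1` is absorbed by the gap between `δ² K M`
and `δ³ K M / 4`. -/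
lemma net_bound_le {δ d M K : ℝ} {n : ℕ} (hd : 1 ≤ d) (hn : (n : ℝ) = 2 * d) (hM : 1 ≤ M)
    (hδ : 0 < δ) (hδ1 : δ ≤ 1)
    (h : 0 < δ ^ 3 * K / 4 - δ * Real.log M - 2 * d / M * Real.log (5 / δ)) :
    (Real.exp 1 * (8 / δ)) ^ n * Real.exp (1 - δ ^ 2 * K * M) ≤
      Real.exp (-(M * (δ ^ 3 * K / 4 - δ * Real.log M - 2 * d / M * Real.log (5 / δ)))) := by
  set L := Real.log (5 / δ) with hL
  have hM0 : 0 < M := by linarith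
  have hlogM : 0 ≤ Real.log M := Real.log_nonneg hM
  have h5 : 5 ≤ 5 / δ := by rw [le_div_iff₀ hδ]; linarith
  have hL1 : 1 ≤ L := by
    rw [hL, Real.le_log_iff_exp_le (by positivity)]
    linarith [Real.exp_one_lt_d9]
  have hbase : Real.exp 1 * (8 / δ) ≤ Real.exp (2 * L) := by
    have e1 : Real.exp (2 * L) = (5 / δ) * (5 / δ) := by
      rw [two_mul, Real.exp_add, hL, Real.exp_log (by positivity)]
    rw [e1]
    have h1 : Real.exp 1 * 8 ≤ 25 := by linarith [Real.exp_one_lt_d9]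
    calc Real.exp 1 * (8 / δ) = Real.exp 1 * 8 / δ := by ring
      _ ≤ 25 / δ := by gcongr
      _ = 5 * (5 / δ) := by ring
      _ ≤ _ := by gcongr
  have hpow : (Real.exp 1 * (8 / δ)) ^ n ≤ Real.exp (4 * d * L) := by
    refine (pow_le_pow_left₀ (by positivity) hbase n).trans_eq ?_
    rw [← Real.exp_nat_mul, hn]; congr 1; ring
  have hX : M * (δ ^ 3 * K / 4 - δ * Real.log M - 2 * d / M * L) =
      δ ^ 3 * K * M / 4 - δ * M * Real.log M - 2 * d * L := by field_simp
  have hpos : 0 < δ ^ 3 * K * M / 4 - δ * M * Real.log M - 2 * d * L := by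
    rw [← hX]; positivity
  have h1 : 0 ≤ δ * M * Real.log M := by positivity
  have hdL : 1 ≤ d * L := by nlinarith
  have h3 : δ ^ 3 * K * M ≤ δ ^ 2 * K * M := by
    have hK3 : 0 < δ ^ 2 * (δ * (K * M)) := by linarith
    have hKM : 0 < K * M := by
      have := (pos_iff_pos_of_mul_pos hK3).mp (by positivity)
      exact (pos_iff_pos_of_mul_pos this).mp hδ
    have : δ ^ 2 * (K * M) * δ ≤ δ ^ 2 * (K * M) * 1 :=
      mul_le_mul_of_nonneg_left hδ1 (by positivity)
    linarith
  calc _ ≤ Real.exp (4 * d * L) * Real.exp (1 - δ ^ 2 * K * M) := by gcongr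
    _ = Real.exp (4 * d * L + (1 - δ ^ 2 * K * M)) := (Real.exp_add _ _).symm
    _ ≤ _ := by
        rw [hX]
        gcongr
        linarith

end DataLocking

/-! ### The locking theorem. -/

theorem theorem3 :
    ∃ C : ℝ, 0 < C ∧
      ∀ (Ω : Type*) [MeasurableSpace Ω] (P : Measure Ω) [IsProbabilityMeasure P]
        (d M K : ℕ) (_ : 0 < d) (_ : 0 < M) (_ : 0 < K)
        (θ : Fin M → Fin K → Fin d → Ω → ℝ)
        (_ : DataLocking.IsZeroMeanIIDPhases P
          (fun (j : Fin M × Fin K × Fin d) => θ j.1 j.2.1 j.2.2))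
        (δ : ℝ) (_ : 0 < δ)
        (_ : (K : ℝ) > 4 / δ ^ 2 * (Real.log M + 2 * d / (δ * M) * Real.log (5 / δ))),
        0 < δ ^ 3 * K / 4 - δ * Real.log M - 2 * d / M * Real.log (5 / δ) ∧
        P.real {w | ((C * δ * Real.logb 2 d : ℝ) : EReal) <
            DataLocking.accessibleInfo (DataLocking.messageState
              (fun m k => DataLocking.phaseVector (fun ω => θ m k ω w)))}
          ≤ Real.exp (-(M * (δ ^ 3 * K / 4 - δ * Real.log M
              - 2 * d / M * Real.log (5 / δ)))) := by
  -- 90 = 3 · 30: the entropy constant times the overlap constant.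
  refine ⟨90, by norm_num, ?_⟩
  intro Ω _ P _ d M K hd hM hK θ hθ δ hδ hKδ
  have hd' : (1 : ℝ) ≤ d := by exact_mod_cast hd
  have hM' : (1 : ℝ) ≤ M := by exact_mod_cast hM
  have hM0 : (0 : ℝ) < M := by linarith
  have hlogd : 0 ≤ Real.logb 2 d := Real.logb_nonneg (by norm_num) hd'
  have hpos : 0 < δ ^ 3 * K / 4 - δ * Real.log M - 2 * d / M * Real.log (5 / δ) := by
    have h1 := mul_lt_mul_of_pos_left hKδ (show 0 < δ ^ 3 / 4 by positivity)
    have h2 : δ ^ 3 / 4 * (4 / δ ^ 2 * (Real.log M + 2 * d / (δ * M) * Real.log (5 / δ))) =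
        δ * Real.log M + 2 * d / M * Real.log (5 / δ) := by field_simp
    rw [h2] at h1
    linarith
  refine ⟨hpos, ?_⟩
  rcases le_or_gt δ 1 with hδ1 | hδ1
  · have hsub : {w | ((90 * δ * Real.logb 2 d : ℝ) : EReal) <
            DataLocking.accessibleInfo (DataLocking.messageState
              (fun m k => DataLocking.phaseVector (fun ω => θ m k ω w)))} ⊆
        {w | ¬ ∀ c : Fin d → ℂ, ∑ ω, ‖c ω‖ ^ 2 = 1 →
          ∑ m, max 0 (1 - DataLocking.meanOverlap
            (fun k ω => Complex.exp (Complex.I * (θ m k ω w : ℂ))) c) ≤ 30 * δ * M} := by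
      intro w hw hgood
      refine not_le.mpr (show (_ : EReal) < _ from hw) ?_
      refine (DataLocking.accessibleInfo_messageState_le hd hM hK
        (fun m k ω => θ m k ω w) hgood).trans (EReal.coe_le_coe_iff.mpr (le_of_eq ?_))
      ring
    have hKM : 4 * Real.log M ≤ K * δ ^ 2 := by
      have hL : 0 ≤ Real.log (5 / δ) :=
        Real.log_nonneg (by rw [le_div_iff₀ hδ]; linarith)
      have h1 : 0 ≤ 2 * d / (δ * M) * Real.log (5 / δ) := by positivity
      have h2 : 4 / δ ^ 2 * Real.log M ≤ K :=
        (mul_le_mul_of_nonneg_left (le_add_of_nonneg_right h1) (by positivity)).trans hKδ.le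
      calc 4 * Real.log M = 4 / δ ^ 2 * Real.log M * δ ^ 2 := by field_simp
        _ ≤ _ := by gcongr
    calc _ ≤ _ := measureReal_mono hsub
      _ ≤ _ := DataLocking.exists_net_bound
          (X := fun j w => Complex.exp (Complex.I * (θ j.1 j.2.1 j.2.2 w : ℂ))) hd hM hK
          hθ.indep hθ.measurable
          (fun j w => by rw [mul_comm, Complex.norm_exp_ofReal_mul_I]) hθ.mean_zero hδ hδ1 hKM
      _ ≤ _ := DataLocking.net_bound_le hd' (by push_cast; ring) hM' hδ hδ1 hpos
  -- For `δ > 1` failure is impossible: shortfalls never exceed 1, so the information is at most `3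
  -- log d`.
  · have hempty : {w | ((90 * δ * Real.logb 2 d : ℝ) : EReal) <
            DataLocking.accessibleInfo (DataLocking.messageState
              (fun m k => DataLocking.phaseVector (fun ω => θ m k ω w)))} = ∅ := by
      ext w
      simp only [Set.mem_ofPred_eq, Set.mem_empty_iff_false, iff_false, not_lt]
      refine (DataLocking.accessibleInfo_messageState_le (Δ := 1) hd hM hK
        (fun m k ω => θ m k ω w) fun c _ => ?_).trans (EReal.coe_le_coe_iff.mpr ?_)
      · calc _ ≤ ∑ _m : Fin M, (1 : ℝ) := Finset.sum_le_sum fun m _ =>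
            max_le zero_le_one (sub_le_self 1 (DataLocking.meanOverlap_nonneg _ c))
          _ = _ := by simp
      · nlinarith
    rw [hempty, measureReal_empty]
    exact (Real.exp_pos _).le
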